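/- Consider $M\ge 1$ terminals sharing a slotted collision channel without feedback. Terminal $j$ monitors a two-state Markov chain $X^{(j)}_n\in\{0,1\}$ with transition probabilities $p_{01},p_{10}\in(0,1]$, not both equal to $1$ (so the chain is irreducible and aperiodic). In each slot the sources first make one transition, independently of each other; then each terminal, independently of the others, transmits the current state of its source with probability $\alpha_c\in[0,1]$ if the source has just changed state and with probability $\alpha_s\in[0,1]$ otherwise. Fix one terminal and let $X_n$ be its source. The receiver keeps an estimate $\hat X_n$: $\hat X_n=X_n$ if in slot $n$ this terminal is the only one to transmit, and $\hat X_n=\hat X_{n-1}$ otherwise. Assume $(\alpha_c,\alpha_s)\notin\{(0,0),(1,1)\}$ and that $M\ge 2$ or $\alpha_c<1$ (so that updates can be delivered and errors can occur). Let $e_n=|X_n-\hat X_n|$. Call $n$ a start instant if $e_n=0$, $e_{n+1}=1$, and a reset instant if $e_n=1$, $e_{n+1}=0$. Let $S[n]$ be the last start instant $\le n$ (and $S[n]=0$ if there is none), and let $\Omega_n=e_n\,(n-S[n])$ be the age of incorrect information (AoII). Then the Markov chain formed by all source states and $\hat X_n$ has exactly one stationary distribution $\pi$. Under $\pi$, start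 and reset instants occur with positive probability. Let $W$ be the time from a start instant to the next reset instant, with its law under $\pi$ conditioned on time $0$ being a start instant, and let $Y$ be the time from a reset instant to the next start instant, with its law under $\pi$ conditioned on time $0$ being a reset instant. Then $\mathbb E[W]$, $\mathbb E[W^2]$ and $\mathbb E[Y]$ are finite, and for every initial law of the chain, almost surely, $$\lim_{\ell\to\infty}\frac1\ell\sum_{n=1}^{\ell}\Omega_n=\frac{\mathbb E[W^2]+\mathbb E[W]}{2\,(\mathbb E[W]+\mathbb E[Y])},$$ each $\Omega_n$ is integrable, and $\lim_{n\to\infty}\mathbb E[\Omega_n]$ exists and has the same value. -/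

import Mathlib

open MeasureTheory ProbabilityTheory

/-- Parameters of the system: `p01`, `p10` are the one-step transition probabilities of every
two-state source; in each slot a terminal transmits with probability `αc` if its source has just
changed state and with probability `αs` otherwise. -/
structure AlohaParams where
  p01 : unitInterval
  p10 : unitInterval
  αc : unitInterval
  αs : unitInterval

/-- State of the system at the end of a slot, from the viewpoint of one tagged terminal: the current
values of the `M` sources, and the receiver's estimate of the source of the tagged terminal
(`false` is `0`, `true` is `1`). -/
abbrev AlohaState (M : ℕ) : Type := (Fin M → Bool) × Bool

namespace AlohaParams

variable (prm : AlohaParams)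

/-- Probability that a source in state `x` changes state at the beginning of a slot. -/
def flipProb (x : Bool) : unitInterval := if x then prm.p10 else prm.p01

/-- Probability that a terminal transmits, given the previous state `x` and the new state `y` of its
source. -/
def txProb (x y : Bool) : unitInterval := if y = x then prm.αs else prm.αc

/-- Behaviour of one terminal over one slot, given the previous state `x` of its source: the joint
law of the new source state and of the indicator of a transmission. -/
noncomputable def nodeLaw (x : Bool) : Measure (Bool × Bool) :=
  (bernoulliMeasure (!x) x (prm.flipProb x)).bind
    fun y => bernoulliMeasure (y, true) (y, false) (prm.txProb x y)

instance (x : Bool) : IsProbabilityMeasure (prm.nodeLaw x) := by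
  refine isProbabilityMeasure_bind (measurable_of_countable _).aemeasurable ?_
  exact Filter.Eventually.of_forall fun y => inferInstance

end AlohaParams

/-- State after a slot of the collision channel: `o j` holds the new state of source `j` and whether
terminal `j` transmits. If the tagged terminal `i` is the only one to transmit, its packet is decoded
and the estimate becomes the current state of source `i`; otherwise the estimate is kept. -/
def slotUpdate {M : ℕ} (i : Fin M) (s : AlohaState M) (o : Fin M → Bool × Bool) : AlohaState M :=
  (fun j => (o j).1,
    if (o i).2 = true ∧ ∀ j, j ≠ i → (o j).2 = false then (o i).1 else s.2)

/-- One slot of the system: all terminals and their sources act independently of each other. -/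
noncomputable def slotKernel {M : ℕ} (prm : AlohaParams) (i : Fin M) :
    Kernel (AlohaState M) (AlohaState M) :=
  Kernel.ofFunOfCountable fun s =>
    (Measure.pi fun j => prm.nodeLaw (s.1 j)).map (slotUpdate i s)

instance {M : ℕ} (prm : AlohaParams) (i : Fin M) : IsMarkovKernel (slotKernel prm i) :=
  ⟨fun s => Measure.isProbabilityMeasure_map (measurable_of_countable (slotUpdate i s)).aemeasurable⟩

/-- Law of the evolution of the system (a path is indexed by the slot number), when the state at
time `0` has law `ν` and the slots then follow `slotKernel`. -/
noncomputable def pathLaw {M : ℕ} (prm : AlohaParams) (i : Fin M) (ν : Measure (AlohaState M)) :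
    Measure (ℕ → AlohaState M) :=
  Kernel.trajMeasure (X := fun _ => AlohaState M) ν fun n =>
    (slotKernel prm i).comap
      (fun h : (Π _ : Finset.Iic n, AlohaState M) => h ⟨n, Finset.mem_Iic.2 le_rfl⟩)
      (measurable_pi_apply _)

/-- `π` is a stationary distribution of the system. -/
def IsStationaryLaw {M : ℕ} (prm : AlohaParams) (i : Fin M) (π : Measure (AlohaState M)) : Prop :=
  IsProbabilityMeasure π ∧ (slotKernel prm i).Invariant π

/-- The estimation error `|X n - X̂ n| ∈ {0, 1}` for the source of the tagged terminal `i`. -/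
def estErr {M : ℕ} (i : Fin M) (ω : ℕ → AlohaState M) (n : ℕ) : ℕ :=
  if (ω n).1 i = (ω n).2 then 0 else 1

/-- `n` is an instant `S` at which the error moves from `0` to `1`: slot `n` is the last slot with
correct knowledge, slot `n + 1` the first one in error. -/
def IsErrStart (e : ℕ → ℕ) (n : ℕ) : Prop := e n = 0 ∧ e (n + 1) = 1

/-- `n` is an instant `R` at which the error moves from `1` to `0`: slot `n` is the last slot in
error, slot `n + 1` the first one with correct knowledge. -/
def IsErrReset (e : ℕ → ℕ) (n : ℕ) : Prop := e n = 1 ∧ e (n + 1) = 0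

/-- The last instant `≤ n` at which the error moved from `0` to `1` (the initial time `0` if there
is none). -/
noncomputable def lastErrStart (e : ℕ → ℕ) (n : ℕ) : ℕ := sSup {m | m ≤ n ∧ IsErrStart e m}

/-- The age of incorrect information of the tagged terminal `i` at time `n`. -/
noncomputable def aoii {M : ℕ} (i : Fin M) (n : ℕ) (ω : ℕ → AlohaState M) : ℝ :=
  (estErr i ω n : ℝ) * ((n : ℝ) - (lastErrStart (estErr i ω) n : ℝ))

/-- The event that an error period starts at time `0`. -/
def startEvent {M : ℕ} (i : Fin M) : Set (ℕ → AlohaState M) := {ω | IsErrStart (estErr i ω) 0}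

/-- The event that a period of correct knowledge starts at time `0`. -/
def resetEvent {M : ℕ} (i : Fin M) : Set (ℕ → AlohaState M) := {ω | IsErrReset (estErr i ω) 0}

/-- Length `W = R - S` of the error period that starts at `S = 0` (`R` is the next reset). -/
noncomputable def errPeriod {M : ℕ} (i : Fin M) (ω : ℕ → AlohaState M) : ℝ :=
  ((sInf {r | 0 < r ∧ IsErrReset (estErr i ω) r} : ℕ) : ℝ)

/-- Length `Y = S - R` of the period of correct knowledge that starts at `R = 0` (`S` is the next
start of an error period). -/
noncomputable def okPeriod {M : ℕ} (i : Fin M) (ω : ℕ → AlohaState M) : ℝ :=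
  ((sInf {s | 0 < s ∧ IsErrStart (estErr i ω) s} : ℕ) : ℝ)

/-- Law of the system in stationary conditions, given that an error period starts at time `0`. -/
noncomputable def errLaw {M : ℕ} (prm : AlohaParams) (i : Fin M) (π : Measure (AlohaState M)) :
    Measure (ℕ → AlohaState M) :=
  ProbabilityTheory.cond (pathLaw prm i π) (startEvent i)

/-- Law of the system in stationary conditions, given that a period of correct knowledge starts at
time `0`. -/
noncomputable def okLaw {M : ℕ} (prm : AlohaParams) (i : Fin M) (π : Measure (AlohaState M)) :
    Measure (ℕ → AlohaState M) :=
  ProbabilityTheory.cond (pathLaw prm i π) (resetEvent i)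

set_option linter.unusedSectionVars false

section

open Filter Topology Finset

/-! ### Averaging operators of a finite Markov chain -/

/-! Write $P$ for the transition operator (`avg`), $E$ for the set of erroneous states, and $T f =
P(1_E f)$ for the operator of the chain killed outside $E$ (`kill`), so that $T^n
1(x)=P_x(X_1,\dots,X_n\in E)$. The AoII is the number of consecutive slots just spent in $E$
(`aoii_eq_age`). The channel enters only through a state $z\notin E$ reachable in two slots from
every state and from which $E$ can be entered in one slot (`exists_common_state`,
`exists_slotKernel_errStates`).

By finiteness this gives $P^2 f\ge \varepsilon f(z)$ for all $f\ge 0$. Hence oscillations of $P^n f$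
are summable, which yields a unique stationary law, convergence to it and solutions of Poisson's
equation. It also makes survival in $E$, or in its complement, summable.

Let $a_k=\int T^{k+1}1\,d\pi$ and $L=\sum_k a_k$. Unrolling the recursion of the age
(`integral_age_mul`) and passing to the limit by dominated convergence shows that the mean age tends
to $L$. For the almost sure statement, Poisson's equation completes the centred accumulated age to a
martingale with increments bounded in $L^2$; its variance is $O(\ell)$, and monotonicity reduces the
claim to a subsequence of squares.

It remains to identify $L$ (`integral_exitTime`). By stationarity $P(0\text{ is a
start},\,W>k)=a_k-a_{k+1}$, so summation by parts gives $E[W;\text{start}]=\pi(E)$ and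
$E[W^2;\text{start}]=2L-\pi(E)$. Likewise $E[Y;\text{reset}]=1-\pi(E)$. Starts and resets have the
same stationary probability, which cancels in the quotient and leaves $L$. -/

theorem summable_of_shift_le_mul {b : ℕ → ℝ} (hb : ∀ n, 0 ≤ b n) {N : ℕ} {c : ℝ} (hc : c < 1)
    (h : ∀ n, b (n + N) ≤ c * b n) : Summable b := by
  refine summable_of_sum_range_le (c := (∑ n ∈ range N, b n) / (1 - c)) hb fun m => ?_
  rw [le_div_iff₀ (by linarith)]
  -- With $s$ the $m$-th partial sum and $H$ the sum of the first $N$ terms, $s\le H+c\,s$; no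
  -- splitting into blocks is needed.
  have h1 : ∑ n ∈ range m, b n ≤ ∑ n ∈ range (N + m), b n :=
    sum_le_sum_of_subset_of_nonneg (range_mono (by omega)) fun _ _ _ => hb _
  rw [sum_range_add] at h1
  have h2 : ∑ n ∈ range m, b (N + n) ≤ c * ∑ n ∈ range m, b n := by
    rw [mul_sum]
    exact sum_le_sum fun n _ => by rw [add_comm]; exact h n
  linarith

/-- By monotonicity $n a_n$ is at most twice the block $\sum_{n/2\le k<n}a_k$, a difference of two
convergent partial sums. -/
theorem tendsto_mul_of_antitone_summable {a : ℕ → ℝ} (ha : Antitone a) (h0 : ∀ n, 0 ≤ a n)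
    (hs : Summable a) : Tendsto (fun n : ℕ => (n : ℝ) * a n) atTop (𝓝 0) := by
  have hS := hs.hasSum.tendsto_sum_nat
  have hhalf : Tendsto (fun n : ℕ => n / 2) atTop atTop :=
    tendsto_atTop_mono (fun n => le_rfl) (Nat.tendsto_div_const_atTop (by norm_num))
  have hlim := (hS.sub (hS.comp hhalf)).const_mul 2
  rw [sub_self, mul_zero] at hlim
  refine squeeze_zero (fun n => mul_nonneg n.cast_nonneg (h0 n)) (fun n => ?_) hlim
  simp only [Function.comp]
  rw [← sum_Ico_eq_sub _ (Nat.div_le_self n 2)]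
  have h1 : ((n - n / 2 : ℕ) : ℝ) * a n ≤ ∑ k ∈ Ico (n / 2) n, a k := by
    rw [← nsmul_eq_mul, ← Nat.card_Ico]
    exact card_nsmul_le_sum _ _ _ fun k hk => ha (mem_Ico.1 hk).2.le
  have h2 : (n : ℝ) ≤ 2 * ((n - n / 2 : ℕ) : ℝ) := by
    have : n ≤ 2 * (n - n / 2) := by omega
    exact_mod_cast this
  nlinarith [h0 n]

namespace FiniteChain

variable {S : Type*} [Fintype S] [MeasurableSpace S] [MeasurableSingletonClass S]

theorem integrable_of_finite (μ : Measure S) [IsFiniteMeasure μ] (f : S → ℝ) : Integrable f μ :=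
  Integrable.of_finite

/-- The averaging operator of a Markov kernel on a finite space. -/
noncomputable def avg (κ : Kernel S S) [IsMarkovKernel κ] : (S → ℝ) →ₗ[ℝ] (S → ℝ) where
  toFun f x := ∫ y, f y ∂κ x
  map_add' f g := by
    ext x
    exact integral_add (integrable_of_finite _ f) (integrable_of_finite _ g)
  map_smul' c f := by
    ext x
    exact integral_const_mul c f

/-- Multiplication by the indicator function of a set. -/
noncomputable def cut (E : Set S) : (S → ℝ) →ₗ[ℝ] (S → ℝ) where
  toFun f := E.indicator f
  map_add' f g := Set.indicator_add _ f g
  map_smul' c f := Set.indicator_const_smul _ c f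

/-- The averaging operator of the chain killed outside of `E`. -/
noncomputable def kill (κ : Kernel S S) [IsMarkovKernel κ] (E : Set S) :
    (S → ℝ) →ₗ[ℝ] (S → ℝ) := avg κ ∘ₗ cut E

variable {κ : Kernel S S} [IsMarkovKernel κ] {E : Set S}

theorem avg_apply (f : S → ℝ) (x : S) : avg κ f x = ∫ y, f y ∂κ x := rfl

theorem kill_apply (f : S → ℝ) : kill κ E f = avg κ (E.indicator f) := rfl

theorem avg_mono {f g : S → ℝ} (h : f ≤ g) : avg κ f ≤ avg κ g := fun _ =>
  integral_mono (integrable_of_finite _ f) (integrable_of_finite _ g) h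

theorem avg_const (c : ℝ) : avg κ (fun _ => c) = fun _ => c := by
  ext x; simp [avg_apply]

theorem avg_one : avg κ 1 = 1 := avg_const 1

theorem avg_pow_one (n : ℕ) : (avg κ ^ n) 1 = 1 := by
  induction n with
  | zero => rfl
  | succ n ih => rw [pow_succ, Module.End.mul_apply, avg_one, ih]

theorem avg_nonneg {f : S → ℝ} (h : 0 ≤ f) : 0 ≤ avg κ f := by
  have := avg_mono (κ := κ) h
  rwa [map_zero] at this

theorem avg_pow_mono (n : ℕ) {f g : S → ℝ} (h : f ≤ g) : (avg κ ^ n) f ≤ (avg κ ^ n) g := by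
  induction n generalizing f g with
  | zero => exact h
  | succ n ih => rw [pow_succ, Module.End.mul_apply, Module.End.mul_apply]; exact ih (avg_mono h)

theorem kill_mono {f g : S → ℝ} (h : f ≤ g) : kill κ E f ≤ kill κ E g :=
  avg_mono (κ := κ) (f := E.indicator f) (g := E.indicator g)
    fun x => Set.indicator_le_indicator (h x)

theorem kill_nonneg {f : S → ℝ} (h : 0 ≤ f) : 0 ≤ kill κ E f := by
  have := kill_mono (κ := κ) (E := E) h
  rwa [map_zero] at this

theorem kill_pow_mono (n : ℕ) {f g : S → ℝ} (h : f ≤ g) :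
    (kill κ E ^ n) f ≤ (kill κ E ^ n) g := by
  induction n generalizing f g with
  | zero => exact h
  | succ n ih => rw [pow_succ, Module.End.mul_apply, Module.End.mul_apply]; exact ih (kill_mono h)

theorem kill_pow_nonneg (n : ℕ) {f : S → ℝ} (h : 0 ≤ f) : 0 ≤ (kill κ E ^ n) f := by
  have := kill_pow_mono (κ := κ) (E := E) n h
  rwa [map_zero] at this

theorem kill_le_avg {f : S → ℝ} (h : 0 ≤ f) : kill κ E f ≤ avg κ f :=
  avg_mono (Set.indicator_le_self' fun _ _ => h _)

theorem kill_pow_le_avg_pow (n : ℕ) {f : S → ℝ} (h : 0 ≤ f) :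
    (kill κ E ^ n) f ≤ (avg κ ^ n) f := by
  induction n generalizing f with
  | zero => exact le_rfl
  | succ n ih =>
    rw [pow_succ, Module.End.mul_apply, pow_succ, Module.End.mul_apply]
    exact (ih (kill_nonneg h)).trans (avg_pow_mono n (kill_le_avg h))

theorem kill_pow_one_le_one (n : ℕ) : (kill κ E ^ n) 1 ≤ 1 :=
  (kill_pow_le_avg_pow n zero_le_one).trans_eq (avg_pow_one n)

theorem kill_pow_one_antitone : Antitone fun n => (kill κ E ^ n) 1 :=
  antitone_nat_of_succ_le fun n => by
    rw [pow_succ, Module.End.mul_apply]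
    exact kill_pow_mono n (by simpa using kill_pow_one_le_one (κ := κ) (E := E) 1)

/-- Survival probabilities are summable as soon as survival for some number of steps is uniformly
uncertain. -/
theorem summable_norm_kill_pow_one {N : ℕ} {c : ℝ} (hc : c < 1)
    (h : (kill κ E ^ N) 1 ≤ fun _ => c) : Summable fun n => ‖(kill κ E ^ n) (1 : S → ℝ)‖ := by
  rcases isEmpty_or_nonempty S with _ | ⟨⟨s⟩⟩
  · exact summable_zero.congr fun n => by rw [Subsingleton.elim ((kill κ E ^ n) 1) 0, norm_zero]
  have hc0 : 0 ≤ c := le_trans (kill_pow_nonneg N zero_le_one s) (h s)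
  refine summable_of_shift_le_mul (fun n => norm_nonneg _) hc (N := N) fun n => ?_
  refine (pi_norm_le_iff_of_nonneg (by positivity)).2 fun x => ?_
  rw [Real.norm_of_nonneg (kill_pow_nonneg _ zero_le_one x), pow_add, Module.End.mul_apply]
  have h1 := kill_pow_mono (κ := κ) (E := E) n (h.trans_eq
    (show (fun _ => c) = c • (1 : S → ℝ) by ext; simp)) x
  rw [map_smul] at h1
  refine h1.trans ?_
  exact mul_le_mul_of_nonneg_left ((le_abs_self _).trans
    (norm_le_pi_norm ((kill κ E ^ n) (1 : S → ℝ)) x)) hc0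

/-! ### Convergence to equilibrium -/

/-- Oscillation of a function. -/
noncomputable def osc (f : S → ℝ) : ℝ := ‖fun p : S × S => f p.1 - f p.2‖

theorem osc_nonneg (f : S → ℝ) : 0 ≤ osc f := norm_nonneg _

theorem sub_le_osc (f : S → ℝ) (x y : S) : f x - f y ≤ osc f :=
  (le_abs_self _).trans (norm_le_pi_norm (fun p : S × S => f p.1 - f p.2) (x, y))

theorem osc_le {f : S → ℝ} {c : ℝ} (hc : 0 ≤ c) (h : ∀ x y, f x - f y ≤ c) : osc f ≤ c :=
  (pi_norm_le_iff_of_nonneg hc).2 fun p => abs_le.2 ⟨by linarith [h p.2 p.1], h p.1 p.2⟩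

/-- Doeblin's contraction estimate. -/
theorem osc_avg_pow_le {N : ℕ} {ε : ℝ} (hε : ε ≤ 1) {z : S}
    (hz : ∀ f : S → ℝ, 0 ≤ f → (fun _ => ε * f z) ≤ (avg κ ^ N) f) (f : S → ℝ) :
    osc ((avg κ ^ N) f) ≤ (1 - ε) * osc f := by
  refine osc_le (mul_nonneg (by linarith) (osc_nonneg f)) fun x y => ?_
  have : Nonempty S := ⟨x⟩
  obtain ⟨b, hb⟩ := Finite.exists_max f
  obtain ⟨a, ha⟩ := Finite.exists_min f
  -- The minorization is applied to the nonnegative functions $\max f-f$ at $x$ and $f-\min f$ at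
  -- $y$. On adding the two bounds, $f(z)$ cancels.
  have h1 := hz (f b • 1 - f) (fun s => by simpa using hb s) x
  have h2 := hz (f - f a • 1) (fun s => by simpa using ha s) y
  rw [map_sub, map_smul, avg_pow_one] at h1 h2
  simp only [Pi.sub_apply, Pi.smul_apply, Pi.one_apply, smul_eq_mul, mul_one] at h1 h2
  nlinarith [sub_le_osc f b a]

theorem summable_osc {N : ℕ} {ε : ℝ} (hε : ε ≤ 1) (hε0 : 0 < ε) {z : S}
    (hz : ∀ f : S → ℝ, 0 ≤ f → (fun _ => ε * f z) ≤ (avg κ ^ N) f) (f : S → ℝ) :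
    Summable fun n => osc ((avg κ ^ n) f) :=
  summable_of_shift_le_mul (fun n => osc_nonneg _) (by linarith : 1 - ε < 1) (N := N) fun n => by
    rw [add_comm, pow_add, Module.End.mul_apply]
    exact osc_avg_pow_le hε hz _

/-- An average lies within the range of $f$. Taken with the stationary law it controls the distance
to equilibrium; taken with `κ x` it controls successive iterates of $P$. -/
theorem abs_integral_sub_le_osc (μ : Measure S) [IsProbabilityMeasure μ] (f : S → ℝ) (c : S) :
    |f c - ∫ x, f x ∂μ| ≤ osc f := by
  have h1 : ∫ x, (f c - f x) ∂μ = f c - ∫ x, f x ∂μ := by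
    rw [integral_sub (integrable_const _) (integrable_of_finite _ f)]; simp
  rw [← h1, ← Real.norm_eq_abs]
  refine (norm_integral_le_of_norm_le_const (C := osc f) (.of_forall fun x => ?_)).trans (by simp)
  exact abs_le.2 ⟨by linarith [sub_le_osc f x c], sub_le_osc f c x⟩

theorem integral_bind_kernel (π : Measure S) [IsProbabilityMeasure π] (f : S → ℝ) :
    ∫ x, f x ∂(π.bind κ) = ∫ x, avg κ f x ∂π := by
  have h := Kernel.integral_comp (κ := Kernel.const Unit π) (η := κ) (a := ())
    (integrable_of_finite _ f)
  rwa [Kernel.comp_apply, Kernel.const_apply] at h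

theorem integral_avg {π : Measure S} [IsProbabilityMeasure π] (hπ : κ.Invariant π) (f : S → ℝ) :
    ∫ x, avg κ f x ∂π = ∫ x, f x ∂π := by
  conv_rhs => rw [← hπ.def]
  rw [integral_bind_kernel]

theorem integral_avg_pow {π : Measure S} [IsProbabilityMeasure π] (hπ : κ.Invariant π) (n : ℕ)
    (f : S → ℝ) : ∫ x, (avg κ ^ n) f x ∂π = ∫ x, f x ∂π := by
  induction n generalizing f with
  | zero => rfl
  | succ n ih => rw [pow_succ, Module.End.mul_apply, ih, integral_avg hπ]

theorem abs_avg_pow_sub_le {π : Measure S} [IsProbabilityMeasure π] (hπ : κ.Invariant π)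
    (n : ℕ) (f : S → ℝ) (x : S) :
    |(avg κ ^ n) f x - ∫ y, f y ∂π| ≤ osc ((avg κ ^ n) f) := by
  rw [← integral_avg_pow hπ n f]
  exact abs_integral_sub_le_osc π _ x

theorem measure_ext_integral {π π' : Measure S} [IsProbabilityMeasure π] [IsProbabilityMeasure π']
    (h : ∀ f : S → ℝ, ∫ x, f x ∂π = ∫ x, f x ∂π') : π = π' := by
  refine Measure.ext_of_singleton fun s => ?_
  have := h (({s} : Set S).indicator 1)
  rw [integral_indicator_one (measurableSet_singleton s),
    integral_indicator_one (measurableSet_singleton s)] at this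
  exact (measureReal_eq_measureReal_iff).1 this

theorem tendsto_avg_pow {π : Measure S} [IsProbabilityMeasure π] (hπ : κ.Invariant π)
    (hosc : ∀ f, Summable fun n => osc ((avg κ ^ n) f)) (f : S → ℝ) (x : S) :
    Tendsto (fun n => (avg κ ^ n) f x) atTop (𝓝 (∫ y, f y ∂π)) := by
  rw [tendsto_iff_dist_tendsto_zero]
  exact squeeze_zero (fun _ => dist_nonneg) (fun n => abs_avg_pow_sub_le hπ n f x)
    (hosc f).tendsto_atTop_zero

theorem invariant_unique [Nonempty S] (hosc : ∀ f, Summable fun n => osc ((avg κ ^ n) f))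
    {π π' : Measure S} [IsProbabilityMeasure π] [IsProbabilityMeasure π'] (hπ : κ.Invariant π)
    (hπ' : κ.Invariant π') : π = π' :=
  measure_ext_integral fun f => tendsto_nhds_unique
    (tendsto_avg_pow hπ hosc f (Classical.arbitrary S))
    (tendsto_avg_pow hπ' hosc f (Classical.arbitrary S))

theorem exists_tendsto_avg_pow (hosc : ∀ f, Summable fun n => osc ((avg κ ^ n) f)) (f : S → ℝ)
    (x : S) : ∃ l, Tendsto (fun n => (avg κ ^ n) f x) atTop (𝓝 l) := by
  refine cauchySeq_tendsto_of_complete (cauchySeq_of_summable_dist ?_)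
  refine (hosc f).of_nonneg_of_le (fun _ => dist_nonneg) fun n => ?_
  rw [pow_succ', Module.End.mul_apply, Real.dist_eq]
  exact abs_integral_sub_le_osc (κ x) _ x

theorem exists_invariant [Nonempty S] (hosc : ∀ f, Summable fun n => osc ((avg κ ^ n) f)) :
    ∃ π : Measure S, IsProbabilityMeasure π ∧ κ.Invariant π := by
  classical
  let x₀ := Classical.arbitrary S
  -- The limit functional along $P^n$ from $x_0$ is linear, positive, normalized and $P$-invariant;
  -- its values on point indicators are the weights of the stationary law.
  choose l hl using fun f => exists_tendsto_avg_pow hosc f x₀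
  have hsum : ∀ f : S → ℝ, l f = ∑ s, f s * l (Pi.single s 1) := fun f => by
    refine tendsto_nhds_unique (hl f) ?_
    refine (tendsto_finsetSum univ fun s _ => (hl (Pi.single s 1)).const_mul (f s)).congr
      fun n => ?_
    conv_rhs => rw [pi_eq_sum_univ' f, map_sum, Finset.sum_apply]
    simp
  have h0 : ∀ s, 0 ≤ l (Pi.single s 1) := fun s =>
    ge_of_tendsto' (hl _) fun n => by
      have := avg_pow_mono (κ := κ) n (f := 0) (g := Pi.single s 1)
        (Pi.single_nonneg.2 zero_le_one) x₀
      rwa [map_zero] at this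
  have h1 : l 1 = 1 :=
    tendsto_nhds_unique (hl 1) (tendsto_const_nhds.congr fun n => by rw [avg_pow_one]; rfl)
  have hinv : ∀ f, l (avg κ f) = l f := fun f =>
    tendsto_nhds_unique (hl _) (((tendsto_add_atTop_iff_nat 1).2 (hl f)).congr fun n => by
      rw [pow_succ, Module.End.mul_apply])
  let π : Measure S := ∑ s, ENNReal.ofReal (l (Pi.single s 1)) • Measure.dirac s
  have hP : IsProbabilityMeasure π := ⟨by
    simp only [π, Measure.coe_finsetSum, Finset.sum_apply, Measure.smul_apply, measure_univ,
      smul_eq_mul, mul_one]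
    rw [← ENNReal.ofReal_sum_of_nonneg fun s _ => h0 s]
    have := hsum 1
    simp only [Pi.one_apply, one_mul] at this
    rw [← this, h1, ENNReal.ofReal_one]⟩
  have hint : ∀ f : S → ℝ, ∫ x, f x ∂π = l f := fun f => by
    rw [hsum f, integral_finsetSum_measure fun s _ =>
      (integrable_of_finite (Measure.dirac s) f).smul_measure ENNReal.ofReal_ne_top]
    refine Finset.sum_congr rfl fun s _ => ?_
    rw [integral_smul_measure, integral_dirac, ENNReal.toReal_ofReal (h0 s), smul_eq_mul, mul_comm]
  refine ⟨π, hP, ?_⟩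
  have : IsProbabilityMeasure (π.bind κ) :=
    isProbabilityMeasure_bind κ.measurable.aemeasurable (.of_forall fun _ => inferInstance)
  refine measure_ext_integral (π := π.bind κ) fun f => ?_
  rw [integral_bind_kernel, hint f, ← hinv f, ← hint]

/-! ### Solutions of the renewal and Poisson equations -/

/-- Expected number of steps that the killed chain survives, including the initial one. -/
noncomputable def lifetime (κ : Kernel S S) [IsMarkovKernel κ] (E : Set S) : S → ℝ :=
  ∑' n, (kill κ E ^ n) 1

theorem hasSum_map_of_hasSum {f : ℕ → S → ℝ} {g : S → ℝ} (T : (S → ℝ) →ₗ[ℝ] (S → ℝ))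
    (h : HasSum f g) : HasSum (fun n => T (f n)) (T g) :=
  h.map T T.continuous_of_finiteDimensional

theorem hasSum_lifetime (hT : Summable fun n => ‖(kill κ E ^ n) (1 : S → ℝ)‖) :
    HasSum (fun n => (kill κ E ^ n) 1) (lifetime κ E) := hT.of_norm.hasSum

theorem kill_lifetime (hT : Summable fun n => ‖(kill κ E ^ n) (1 : S → ℝ)‖) :
    kill κ E (lifetime κ E) = lifetime κ E - 1 := by
  have h := hasSum_map_of_hasSum (kill κ E) (hasSum_lifetime hT)
  have h' := (hasSum_nat_add_iff' 1).2 (hasSum_lifetime hT)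
  simp only [range_one, sum_singleton, pow_zero, Module.End.one_apply] at h'
  refine h.unique (h'.congr_fun fun n => ?_)
  rw [pow_succ', Module.End.mul_apply]

theorem one_le_lifetime (hT : Summable fun n => ‖(kill κ E ^ n) (1 : S → ℝ)‖) :
    1 ≤ lifetime κ E := by
  have h := kill_nonneg (κ := κ) (E := E) (f := lifetime κ E)
    ((hasSum_lifetime hT).nonneg fun n => kill_pow_nonneg n zero_le_one)
  rw [kill_lifetime hT] at h
  exact sub_nonneg.1 h

theorem hasSum_integral {π : Measure S} [IsProbabilityMeasure π] {f : ℕ → S → ℝ} {g : S → ℝ}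
    (h : HasSum f g) : HasSum (fun n => ∫ x, f n x ∂π) (∫ x, g x ∂π) := by
  simp only [integral_fintype (integrable_of_finite π _)]
  exact _root_.hasSum_sum fun x _ => ((Pi.hasSum.1 h) x).const_smul _

/-- The solution is the Neumann series $\sum_n P^n u$. It converges because, for centred $u$, the
sup norm of $P^n u$ is at most its oscillation. -/
theorem exists_poisson_solution {π : Measure S} [IsProbabilityMeasure π] (hπ : κ.Invariant π)
    (hosc : ∀ f, Summable fun n => osc ((avg κ ^ n) f)) {u : S → ℝ} (hu : ∫ x, u x ∂π = 0) :
    ∃ g : S → ℝ, avg κ g = g - u := by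
  have hs : Summable fun n => (avg κ ^ n) u := by
    refine Summable.of_norm_bounded (hosc u) fun n => ?_
    refine (pi_norm_le_iff_of_nonneg (osc_nonneg _)).2 fun x => ?_
    simpa [hu] using abs_avg_pow_sub_le hπ n u x
  refine ⟨∑' n, (avg κ ^ n) u, ?_⟩
  have h := hasSum_map_of_hasSum (avg κ) hs.hasSum
  have h' := (hasSum_nat_add_iff' 1).2 hs.hasSum
  simp only [range_one, sum_singleton, pow_zero, Module.End.one_apply] at h'
  refine h.unique (h'.congr_fun fun n => ?_)
  rw [pow_succ', Module.End.mul_apply]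

/-! ### Path laws -/

/-- The one-step Markov property of a law on the space of paths. -/
def IsMarkovLaw (κ : Kernel S S) [IsMarkovKernel κ] (μ : Measure (ℕ → S)) : Prop :=
  ∀ (n : ℕ) (F : (ℕ → S) → ℝ), DependsOn F (Set.Iic n) → ∀ f : S → ℝ,
    ∫ ω, F ω * f (ω (n + 1)) ∂μ = ∫ ω, F ω * avg κ f (ω n) ∂μ

theorem exists_factor {n : ℕ} {F : (ℕ → S) → ℝ} (hF : DependsOn F (Set.Iic n)) :
    ∃ G : (Π _ : Iic n, S) → ℝ, F = fun ω => G (Preorder.frestrictLe n ω) := by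
  obtain ⟨g, rfl⟩ := dependsOn_iff_exists_comp.1 hF
  exact ⟨fun h => g fun k => h ⟨k.1, Finset.mem_Iic.2 k.2⟩, rfl⟩

/-- A function of finitely many coordinates in a finite state space takes finitely many values, so
every integrability condition below is automatic. -/
theorem integrable_of_dependsOn {n : ℕ} {F : (ℕ → S) → ℝ} (hF : DependsOn F (Set.Iic n))
    (μ : Measure (ℕ → S)) [IsFiniteMeasure μ] : Integrable F μ := by
  obtain ⟨G, rfl⟩ := exists_factor hF
  exact (Integrable.of_finite (μ := μ.map (Preorder.frestrictLe n)) (f := G)).comp_measurable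
    (Preorder.measurable_frestrictLe n)

theorem measurable_of_dependsOn {n : ℕ} {F : (ℕ → S) → ℝ} (hF : DependsOn F (Set.Iic n)) :
    Measurable F := by
  obtain ⟨G, rfl⟩ := exists_factor hF
  exact (measurable_of_countable G).comp (Preorder.measurable_frestrictLe n)

theorem dependsOn_coord {α : Type*} (f : S → α) {m n : ℕ} (h : m ≤ n) :
    DependsOn (fun ω : ℕ → S => f (ω m)) (Set.Iic n) := fun ω ω' hω => by
  simp only [hω m h]

theorem isMarkovLaw_trajMeasure (ν : Measure S) [IsProbabilityMeasure ν] :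
    IsMarkovLaw κ (Kernel.trajMeasure (X := fun _ => S) ν fun n =>
      κ.comap (fun h : (Π _ : Finset.Iic n, S) => h ⟨n, Finset.mem_Iic.2 le_rfl⟩)
        (measurable_pi_apply _)) := by
  intro n F hF f
  obtain ⟨G, rfl⟩ := exists_factor hF
  set K : (n : ℕ) → Kernel (Π _ : Finset.Iic n, S) S := fun n =>
    κ.comap (fun h : (Π _ : Finset.Iic n, S) => h ⟨n, Finset.mem_Iic.2 le_rfl⟩)
      (measurable_pi_apply _) with hK
  -- The joint law of the history up to $n$ and the next state is the composition product of the
  -- history law with the kernel; the Markov property is then Fubini.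
  have key := Kernel.map_frestrictLe_trajMeasure_compProd_eq_map_trajMeasure
    (X := fun _ => S) (κ := K) (μ₀ := ν) (a := n)
  set μ := Kernel.trajMeasure (X := fun _ => S) ν K
  have : IsProbabilityMeasure (μ.map (Preorder.frestrictLe n)) :=
    Measure.isProbabilityMeasure_map (Preorder.measurable_frestrictLe n).aemeasurable
  let H : (Π _ : Finset.Iic n, S) × S → ℝ := fun p => G p.1 * f p.2
  have h1 : ∫ p, H p ∂(μ.map (Preorder.frestrictLe n) ⊗ₘ K n)
      = ∫ ω, G (Preorder.frestrictLe n ω) * avg κ f (ω n) ∂μ := by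
    rw [Measure.integral_compProd Integrable.of_finite,
      integral_map (Preorder.measurable_frestrictLe n).aemeasurable .of_discrete]
    refine integral_congr_ae (.of_forall fun ω => ?_)
    exact integral_const_mul (G (Preorder.frestrictLe n ω)) f
  rw [← h1, key, integral_map (by fun_prop) .of_discrete]

theorem map_zero_trajMeasure (ν : Measure S) [IsProbabilityMeasure ν] :
    (Kernel.trajMeasure (X := fun _ => S) ν fun n =>
      κ.comap (fun h : (Π _ : Finset.Iic n, S) => h ⟨n, Finset.mem_Iic.2 le_rfl⟩)
        (measurable_pi_apply _)).map (fun ω => ω 0) = ν := by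
  set K : (n : ℕ) → Kernel (Π _ : Finset.Iic n, S) S := fun n =>
    κ.comap (fun h : (Π _ : Finset.Iic n, S) => h ⟨n, Finset.mem_Iic.2 le_rfl⟩)
      (measurable_pi_apply _)
  let ev : (Π _ : Finset.Iic 0, S) → S := fun h => h ⟨0, Finset.mem_Iic.2 le_rfl⟩
  have hev : Measurable ev := measurable_pi_apply _
  change (Kernel.trajMeasure (X := fun _ => S) ν K).map (ev ∘ Preorder.frestrictLe 0) = ν
  rw [← Measure.map_map hev (Preorder.measurable_frestrictLe 0),
    Kernel.trajMeasure, Measure.map_comp _ _ (Preorder.measurable_frestrictLe 0),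
    Kernel.traj_map_frestrictLe, Kernel.partialTraj_self, Measure.id_comp,
    Measure.map_map hev (MeasurableEquiv.measurable _)]
  exact Measure.map_id

section Law

variable {μ : Measure (ℕ → S)} [IsProbabilityMeasure μ]

theorem integral_coord (hμ : IsMarkovLaw κ μ) (n : ℕ) (f : S → ℝ) :
    ∫ ω, f (ω n) ∂μ = ∫ ω, (avg κ ^ n) f (ω 0) ∂μ := by
  induction n generalizing f with
  | zero => rfl
  | succ n ih =>
    have h := hμ n (fun _ => 1) (fun _ _ _ => rfl) f
    simp only [one_mul] at h
    rw [h, ih, pow_succ, Module.End.mul_apply]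

theorem tendsto_integral_coord (hμ : IsMarkovLaw κ μ) {π : Measure S} [IsProbabilityMeasure π]
    (hπ : κ.Invariant π) (hosc : ∀ f, Summable fun n => osc ((avg κ ^ n) f)) (f : S → ℝ) :
    Tendsto (fun n => ∫ ω, f (ω n) ∂μ) atTop (𝓝 (∫ x, f x ∂π)) := by
  rw [tendsto_iff_dist_tendsto_zero]
  refine squeeze_zero (fun _ => dist_nonneg) (fun n => ?_) (hosc f).tendsto_atTop_zero
  rw [integral_coord hμ, Real.dist_eq]
  have h1 : ∫ ω, ((avg κ ^ n) f (ω 0) - ∫ x, f x ∂π) ∂μ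
      = ∫ ω, (avg κ ^ n) f (ω 0) ∂μ - ∫ x, f x ∂π := by
    rw [integral_sub (integrable_of_dependsOn (dependsOn_coord _ le_rfl) μ)
      (integrable_const _)]
    simp
  rw [← h1, ← Real.norm_eq_abs]
  exact (norm_integral_le_of_norm_le_const
    (.of_forall fun ω => abs_avg_pow_sub_le hπ n f (ω 0))).trans (by simp)

end Law

/-! ### The age process -/

/-- Number of consecutive slots spent in `E`, not counting the initial one. -/
noncomputable def age (E : Set S) (ω : ℕ → S) : ℕ → ℝ
  | 0 => 0
  | n + 1 => E.indicator (fun _ => age E ω n + 1) (ω (n + 1))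

theorem age_nonneg (ω : ℕ → S) (n : ℕ) : 0 ≤ age E ω n := by
  induction n with
  | zero => exact le_rfl
  | succ n ih => exact Set.indicator_nonneg (fun _ _ => by positivity) _

theorem dependsOn_age {m n : ℕ} (h : m ≤ n) : DependsOn (fun ω => age E ω m) (Set.Iic n) := by
  induction m with
  | zero => exact fun _ _ _ => rfl
  | succ m ih =>
    intro ω ω' hω
    have h1 : age E ω m = age E ω' m := ih (by omega) hω
    simp only [age, h1, hω (m + 1) h]

theorem dependsOn_age_coord {m n : ℕ} (h : m ≤ n) (φ : S → ℝ → ℝ) :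
    DependsOn (fun ω => φ (ω m) (age E ω m)) (Set.Iic n) := fun ω ω' hω => by
  have h1 : age E ω m = age E ω' m := dependsOn_age h hω
  simp only [h1, hω m h]

/-- This puts all dependence on the new state into $1_E f$, so that the one-step Markov property
produces `kill`. -/
theorem age_succ_mul (ω : ℕ → S) (n : ℕ) (f : S → ℝ) :
    age E ω (n + 1) * f (ω (n + 1)) = (age E ω n + 1) * E.indicator f (ω (n + 1)) := by
  by_cases h : ω (n + 1) ∈ E <;> simp [age, h]

section Law

variable {μ : Measure (ℕ → S)} [IsProbabilityMeasure μ]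

theorem integrable_age_coord (n : ℕ) (φ : S → ℝ → ℝ) :
    Integrable (fun ω => φ (ω n) (age E ω n)) μ :=
  integrable_of_dependsOn (dependsOn_age_coord le_rfl φ) μ

/-- The age at $n$ counts the $k<n$ for which $X_{n-k},\dots,X_n$ all lie in $E$, and the $k$-th
term is the contribution of that event. In the induction, one conditioning step replaces $f$ by $Tf$
and adds a term $Tf(X_n)$. -/
theorem integral_age_mul (hμ : IsMarkovLaw κ μ) (n : ℕ) (f : S → ℝ) :
    ∫ ω, age E ω n * f (ω n) ∂μ
      = ∑ k ∈ range n, ∫ ω, (kill κ E ^ (k + 1)) f (ω (n - 1 - k)) ∂μ := by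
  induction n generalizing f with
  | zero => simp [age]
  | succ n ih =>
    simp_rw [age_succ_mul]
    rw [hμ n _ (dependsOn_age_coord (E := E) le_rfl fun _ w => w + 1), sum_range_succ']
    have h1 : ∫ ω, (age E ω n + 1) * avg κ (E.indicator f) (ω n) ∂μ
        = ∫ ω, age E ω n * kill κ E f (ω n) ∂μ + ∫ ω, kill κ E f (ω n) ∂μ := by
      rw [← integral_add (integrable_age_coord n fun x w => w * kill κ E f x)
        (integrable_age_coord (E := E) n fun x _ => kill κ E f x)]
      exact integral_congr_ae (.of_forall fun ω => by simp only [kill_apply]; ring)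
    rw [h1, ih]
    congr 1
    refine Finset.sum_congr rfl fun k _ => ?_
    rw [pow_succ _ (k + 1), Module.End.mul_apply]
    congr! 4
    omega

/-- The expected age converges to its stationary value. -/
theorem tendsto_integral_age (hμ : IsMarkovLaw κ μ) {π : Measure S} [IsProbabilityMeasure π]
    (hπ : κ.Invariant π) (hosc : ∀ f, Summable fun n => osc ((avg κ ^ n) f))
    (hT : Summable fun n => ‖(kill κ E ^ n) (1 : S → ℝ)‖) :
    Tendsto (fun n => ∫ ω, age E ω n ∂μ) atTop
      (𝓝 (∑' k, ∫ x, (kill κ E ^ (k + 1)) 1 x ∂π)) := by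
  have h1 : ∀ n, ∫ ω, age E ω n ∂μ = ∑' k, if k < n then
      ∫ ω, (kill κ E ^ (k + 1)) 1 (ω (n - 1 - k)) ∂μ else 0 := fun n => by
    have h := integral_age_mul (E := E) hμ n 1
    simp only [Pi.one_apply, mul_one] at h
    rw [h, tsum_eq_sum (s := range n) fun k hk => if_neg (by simpa using hk)]
    exact Finset.sum_congr rfl fun k hk => (if_pos (mem_range.1 hk)).symm
  simp_rw [h1]
  -- The terms converge for each fixed $k$ and are dominated by the summable $\|T^{k+1}1\|$.
  refine tendsto_tsum_of_dominated_convergence ((summable_nat_add_iff 1).2 hT) (fun k => ?_)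
    (.of_forall fun n k => ?_)
  · have h2 := (tendsto_integral_coord hμ hπ hosc ((kill κ E ^ (k + 1)) 1)).comp
      (tendsto_sub_atTop_nat (k + 1))
    refine h2.congr' ?_
    filter_upwards [eventually_gt_atTop k] with n hn
    rw [if_pos hn, Function.comp]
    congr! 4
    omega
  · split_ifs
    · exact (norm_integral_le_of_norm_le_const
        (.of_forall fun ω => norm_le_pi_norm _ _)).trans (by simp)
    · simp

end Law

/-! ### Moment bounds and the strong law for the age -/

theorem abs_le_norm (f : S → ℝ) (x : S) : |f x| ≤ ‖f‖ := norm_le_pi_norm f x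

variable {μ : Measure (ℕ → S)} [IsProbabilityMeasure μ]

/-- A Lyapunov argument with $\mathrm{age}^2\, r(X)$: since $Tr=r-1$ and $1\le r\le R$, one step
multiplies its mean by a factor below $1$, up to a constant. -/
theorem exists_integral_age_sq_le (hμ : IsMarkovLaw κ μ)
    (hT : Summable fun n => ‖(kill κ E ^ n) (1 : S → ℝ)‖) :
    ∃ C, ∀ n, ∫ ω, age E ω n ^ 2 ∂μ ≤ C := by
  set r := lifetime κ E with hr
  have hr1 : ∀ x, 1 ≤ r x := one_le_lifetime hT
  have hTr := kill_lifetime hT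
  set R : ℝ := ‖r‖ + 1
  have hR1 : 1 ≤ R := by simp [R]
  have hrR : ∀ x, r x ≤ R := fun x => by
    have := (le_abs_self _).trans (abs_le_norm r x)
    simp only [R]; linarith
  have hR0 : 0 < R := by linarith
  -- With $\delta=1/R$ one has $r-1\le(1-\delta)r$ and $(w+1)^2\le(1+\delta)w^2+1+R$, hence the
  -- factor $1-\delta^2$.
  obtain ⟨δ, hδ⟩ : ∃ δ, δ = R⁻¹ := ⟨_, rfl⟩
  have hδR : δ * R = 1 := by rw [hδ]; exact inv_mul_cancel₀ hR0.ne'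
  have hδ0 : 0 < δ := by rw [hδ]; exact inv_pos.2 hR0
  have hδ1 : δ ≤ 1 := by nlinarith
  -- The bound is the fixed point of $c\mapsto(1-\delta^2)c+(1+R)R$, because $\delta R=1$.
  have key : ∀ n, ∫ ω, age E ω n ^ 2 * r (ω n) ∂μ ≤ (1 + R) * R * R ^ 2 := by
    intro n
    induction n with
    | zero => simp [age]; positivity
    | succ n ih =>
      have h1 : ∀ ω : ℕ → S, age E ω (n + 1) ^ 2 * r (ω (n + 1))
          = (age E ω n + 1) ^ 2 * E.indicator r (ω (n + 1)) := fun ω => by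
        by_cases h : ω (n + 1) ∈ E <;> simp [age, h]
      simp_rw [h1]
      rw [hμ n _ (dependsOn_age_coord (E := E) le_rfl fun _ w => (w + 1) ^ 2)]
      have h2 : ∫ ω, (age E ω n + 1) ^ 2 * avg κ (E.indicator r) (ω n) ∂μ
          ≤ ∫ ω, ((1 - δ ^ 2) * (age E ω n ^ 2 * r (ω n)) + (1 + R) * R) ∂μ := by
        refine integral_mono
          (integrable_age_coord n fun x w => (w + 1) ^ 2 * avg κ (E.indicator r) x)
          (integrable_age_coord n fun x w => (1 - δ ^ 2) * (w ^ 2 * r x) + (1 + R) * R)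
          fun ω => ?_
        have h3 : avg κ (E.indicator r) (ω n) = r (ω n) - 1 := congrFun hTr (ω n)
        simp only [h3]
        have hw := age_nonneg (E := E) ω n
        generalize age E ω n = w at hw
        have hx1 := hr1 (ω n)
        have hxR := hrR (ω n)
        generalize r (ω n) = x at hx1 hxR
        have h4 : x - 1 ≤ (1 - δ) * x := by nlinarith
        have h5 : (w + 1) ^ 2 ≤ (1 + δ) * w ^ 2 + (1 + R) := by
          have h6 : 2 * w ≤ δ * w ^ 2 + R := by
            have : δ * (w - R) ^ 2 = δ * w ^ 2 - 2 * (δ * R) * w + (δ * R) * R := by ring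
            rw [hδR] at this
            nlinarith [mul_nonneg hδ0.le (sq_nonneg (w - R))]
          nlinarith
        calc (w + 1) ^ 2 * (x - 1) ≤ ((1 + δ) * w ^ 2 + (1 + R)) * ((1 - δ) * x) :=
              mul_le_mul h5 h4 (by linarith) (by positivity)
          _ = (1 - δ ^ 2) * (w ^ 2 * x) + (1 + R) * ((1 - δ) * x) := by ring
          _ ≤ _ := by
              have : (1 - δ) * x ≤ R := by nlinarith
              nlinarith
      refine h2.trans ?_
      rw [integral_add ((integrable_age_coord n fun x w => w ^ 2 * r x).const_mul _)
        (integrable_const _), integral_const_mul]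
      simp only [integral_const, probReal_univ, smul_eq_mul, one_mul]
      have h7 : (1 - δ ^ 2) * ∫ ω, age E ω n ^ 2 * r (ω n) ∂μ
          ≤ (1 - δ ^ 2) * ((1 + R) * R * R ^ 2) :=
        mul_le_mul_of_nonneg_left ih (by nlinarith)
      have h8 : δ ^ 2 * ((1 + R) * R * R ^ 2) = (1 + R) * R * (δ * R) ^ 2 := by ring
      rw [hδR] at h8
      linarith
  refine ⟨_, fun n => le_trans ?_ (key n)⟩
  refine integral_mono (integrable_age_coord n fun _ w => w ^ 2)
    (integrable_age_coord n fun x w => w ^ 2 * r x) fun ω => ?_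
  exact le_mul_of_one_le_right (sq_nonneg _) (hr1 _)

theorem dependsOn_sum_age (l : ℕ) (c : ℝ) (φ : S → ℝ → ℝ → ℝ) :
    DependsOn (fun ω => φ (ω l) (age E ω l) (∑ m ∈ range l, (age E ω m - c))) (Set.Iic l) :=
  fun ω ω' hω => by
    have h1 : ∀ m ≤ l, age E ω m = age E ω' m := fun m hm => dependsOn_age hm hω
    have h2 : ∑ m ∈ range l, (age E ω m - c) = ∑ m ∈ range l, (age E ω' m - c) :=
      Finset.sum_congr rfl fun m hm => by rw [h1 m (mem_range.1 hm).le]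
    simp only [h1 l le_rfl, hω l Set.self_mem_Iic, h2]

/-- The variance of the accumulated age grows at most linearly. -/
theorem exists_integral_sum_age_sq_le (hμ : IsMarkovLaw κ μ) {π : Measure S}
    [IsProbabilityMeasure π] (hπ : κ.Invariant π)
    (hosc : ∀ f, Summable fun n => osc ((avg κ ^ n) f))
    (hT : Summable fun n => ‖(kill κ E ^ n) (1 : S → ℝ)‖) :
    ∃ C, ∀ l : ℕ, ∫ ω, (∑ m ∈ range l,
      (age E ω m - ∑' k, ∫ x, (kill κ E ^ (k + 1)) 1 x ∂π)) ^ 2 ∂μ ≤ C * (l + 1) := by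
  obtain ⟨C, hC⟩ := exists_integral_age_sq_le hμ hT
  have hL := (hasSum_integral (π := π)
    ((hasSum_nat_add_iff' 1).2 (hasSum_lifetime hT))).tsum_eq
  set L := ∑' k, ∫ x, (kill κ E ^ (k + 1)) 1 x ∂π
  set r := lifetime κ E with hr
  simp only [range_one, sum_singleton, pow_zero, Module.End.one_apply] at hL
  -- The function $r-1-L$ is centred because $r-1=\sum_k T^{k+1}1$ has $\pi$-integral $L$.
  obtain ⟨g, hg⟩ := exists_poisson_solution hπ hosc (u := fun x => (r - 1) x - L) (by
    rw [integral_sub (integrable_of_finite _ _) (integrable_const _), ← hL]; simp)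
  have hTr := kill_lifetime hT
  set Z : ℕ → (ℕ → S) → ℝ := fun l ω => ∑ m ∈ range l, (age E ω m - L) with hZ
  set h : S → ℝ → ℝ := fun x w => g x + w * r x with hh
  -- This is a martingale: $w\,r(x)$ is the future contribution of the present age $w$, and $g$
  -- corrects for what remains. The drift vanishes by $Tr=r-1$ and $Pg=g-(r-1-L)$.
  set N : ℕ → (ℕ → S) → ℝ := fun l ω => Z l ω + h (ω l) (age E ω l) with hN
  -- Chosen so that $A(\mathrm{age}_l+1)$ dominates both the corrector at time $l$ and the increment
  -- of $N$ from $l$ to $l+1$.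
  set A : ℝ := 1 + |L| + 2 * ‖g‖ + 2 * ‖r‖
  have hbound : ∀ (x : S) (w : ℝ), 0 ≤ w → |h x w| ≤ ‖g‖ + w * ‖r‖ := fun x w hw => by
    refine (abs_add_le _ _).trans (add_le_add (abs_le_norm g x) ?_)
    rw [abs_mul, abs_of_nonneg hw]
    exact mul_le_mul_of_nonneg_left (abs_le_norm r x) hw
  have hng : 0 ≤ ‖g‖ := norm_nonneg g
  have hnr : 0 ≤ ‖r‖ := norm_nonneg r
  have hAL : 0 ≤ |L| := abs_nonneg L
  have hA0 : 0 ≤ A := by positivity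
  have hC0 : 0 ≤ C := le_trans (integral_nonneg fun ω => sq_nonneg _) (hC 0)
  have hquad : ∀ l, ∫ ω, (A * (age E ω l + 1)) ^ 2 ∂μ ≤ 2 * A ^ 2 * (C + 1) := fun l => by
    calc ∫ ω, (A * (age E ω l + 1)) ^ 2 ∂μ ≤ ∫ ω, 2 * A ^ 2 * (age E ω l ^ 2 + 1) ∂μ :=
          integral_mono (integrable_age_coord l fun _ w => (A * (w + 1)) ^ 2)
            (integrable_age_coord l fun _ w => 2 * A ^ 2 * (w ^ 2 + 1)) fun ω => by
              dsimp only
              have := mul_nonneg (sq_nonneg A) (sq_nonneg (age E ω l - 1))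
              nlinarith
      _ ≤ _ := by
          rw [integral_const_mul, integral_add (integrable_age_coord l fun _ w => w ^ 2)
            (integrable_const _)]
          simp only [integral_const, probReal_univ, smul_eq_mul, one_mul]
          exact mul_le_mul_of_nonneg_left (by linarith [hC l]) (by positivity)
  have hVsq : ∀ l, ∫ ω, h (ω l) (age E ω l) ^ 2 ∂μ ≤ 2 * A ^ 2 * (C + 1) := fun l => by
    refine le_trans (integral_mono (integrable_age_coord l fun x w => h x w ^ 2)
      (integrable_age_coord l fun _ w => (A * (w + 1)) ^ 2) fun ω => ?_) (hquad l)
    have hw := age_nonneg (E := E) ω l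
    refine sq_le_sq' ?_ ?_
    all_goals
      have h1 := abs_le.1 (hbound (ω l) _ hw)
      simp only [A]
      nlinarith [mul_nonneg hw hnr, mul_nonneg hw hng, mul_nonneg hw hAL]
  have hNN : ∀ l (φ : ℝ → ℝ → ℝ), Integrable (fun ω => φ (N l ω) (N (l + 1) ω)) μ :=
    fun l φ => integrable_of_dependsOn (n := l + 1) (fun ω ω' hω => by
      have h1 := dependsOn_sum_age (E := E) (l + 1) L (fun x w z => z + h x w) hω
      have h2 := dependsOn_sum_age (E := E) l L (fun x w z => z + h x w)
        (fun i hi => hω i (Set.mem_Iic.2 ((Set.mem_Iic.1 hi).trans l.le_succ)))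
      simp only [hN, hZ] at *
      rw [h1, h2]) μ
  have hDsq : ∀ l, ∫ ω, (N (l + 1) ω - N l ω) ^ 2 ∂μ ≤ 2 * A ^ 2 * (C + 1) := fun l => by
    refine le_trans (integral_mono (hNN l fun y z => (z - y) ^ 2)
      (integrable_age_coord l fun _ w => (A * (w + 1)) ^ 2) fun ω => ?_) (hquad l)
    have hw := age_nonneg (E := E) ω l
    have hw' := age_nonneg (E := E) ω (l + 1)
    have hle : age E ω (l + 1) ≤ age E ω l + 1 := by
      rw [age]
      exact Set.indicator_le_self' (fun _ _ => by positivity) _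
    have h1 := abs_le.1 (hbound (ω l) _ hw)
    have h2 := abs_le.1 (hbound (ω (l + 1)) _ hw')
    have h3 := abs_le.1 (le_refl |L|)
    have h4 : age E ω (l + 1) * ‖r‖ ≤ (age E ω l + 1) * ‖r‖ :=
      mul_le_mul_of_nonneg_right hle hnr
    have h5 : N (l + 1) ω - N l ω = (age E ω l - L) + h (ω (l + 1)) (age E ω (l + 1))
        - h (ω l) (age E ω l) := by
      simp only [hN, hZ, sum_range_succ]; ring
    refine sq_le_sq' ?_ ?_
    all_goals
      rw [h5]
      simp only [A]
      nlinarith [mul_nonneg hw hnr, mul_nonneg hw hng, mul_nonneg hw hAL]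
  have hNint : ∀ l (φ : ℝ → ℝ), Integrable (fun ω => φ (N l ω)) μ := fun l φ =>
    integrable_of_dependsOn (dependsOn_sum_age l L fun x w z => φ (z + h x w)) μ
  -- Orthogonality of each increment to the current value is all that the variance recursion needs
  -- of the martingale property.
  have horth : ∀ l, ∫ ω, N l ω * (N (l + 1) ω - N l ω) ∂μ = 0 := fun l => by
    have e1 := hμ l (N l) (dependsOn_sum_age l L fun x w z => z + h x w) g
    have e2 := hμ l (fun ω => N l ω * (age E ω l + 1))
      (dependsOn_sum_age l L fun x w z => (z + h x w) * (w + 1)) (E.indicator r)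
    have i1 : Integrable (fun ω => N l ω * g (ω (l + 1))) μ :=
      integrable_of_dependsOn (n := l + 1) (fun ω ω' hω => by
        have h2 := dependsOn_sum_age (E := E) l L (fun x w z => z + h x w)
          (fun i hi => hω i (Set.mem_Iic.2 ((Set.mem_Iic.1 hi).trans l.le_succ)))
        simp only [hN, hZ] at *
        rw [h2, hω (l + 1) Set.self_mem_Iic]) μ
    have i2 : Integrable (fun ω => N l ω * (age E ω l + 1) * E.indicator r (ω (l + 1))) μ :=
      integrable_of_dependsOn (n := l + 1) (fun ω ω' hω => by
        have h2 := dependsOn_sum_age (E := E) l L (fun x w z => (z + h x w) * (w + 1))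
          (fun i hi => hω i (Set.mem_Iic.2 ((Set.mem_Iic.1 hi).trans l.le_succ)))
        simp only [hN, hZ] at *
        rw [h2, hω (l + 1) Set.self_mem_Iic]) μ
    have i3 : Integrable (fun ω => N l ω * (age E ω l - L - h (ω l) (age E ω l))) μ :=
      integrable_of_dependsOn (dependsOn_sum_age l L
        fun x w z => (z + h x w) * (w - L - h x w)) μ
    have i4 : Integrable (fun ω => N l ω * avg κ g (ω l)) μ :=
      integrable_of_dependsOn (dependsOn_sum_age l L fun x w z => (z + h x w) * avg κ g x) μ
    have i5 : Integrable (fun ω => N l ω * (age E ω l + 1) * avg κ (E.indicator r) (ω l)) μ :=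
      integrable_of_dependsOn (dependsOn_sum_age l L
        fun x w z => (z + h x w) * (w + 1) * avg κ (E.indicator r) x) μ
    have i12 : Integrable (fun ω => N l ω * g (ω (l + 1))
        + N l ω * (age E ω l + 1) * E.indicator r (ω (l + 1))) μ := i1.add i2
    have i45 : Integrable (fun ω => N l ω * avg κ g (ω l)
        + N l ω * (age E ω l + 1) * avg κ (E.indicator r) (ω l)) μ := i4.add i5
    calc ∫ ω, N l ω * (N (l + 1) ω - N l ω) ∂μ
        = ∫ ω, (N l ω * g (ω (l + 1)) + N l ω * (age E ω l + 1) * E.indicator r (ω (l + 1))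
            + N l ω * (age E ω l - L - h (ω l) (age E ω l))) ∂μ := by
          refine integral_congr_ae (.of_forall fun ω => ?_)
          have h5 : N (l + 1) ω - N l ω = (age E ω l - L) + h (ω (l + 1)) (age E ω (l + 1))
              - h (ω l) (age E ω l) := by
            simp only [hN, hZ, sum_range_succ]; ring
          have h6 : h (ω (l + 1)) (age E ω (l + 1))
              = g (ω (l + 1)) + (age E ω l + 1) * E.indicator r (ω (l + 1)) := by
            rw [← age_succ_mul]
          dsimp only
          rw [h5, h6]
          ring
      _ = ∫ ω, (N l ω * avg κ g (ω l) + N l ω * (age E ω l + 1) * avg κ (E.indicator r) (ω l)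
            + N l ω * (age E ω l - L - h (ω l) (age E ω l))) ∂μ := by
          rw [integral_add i12 i3, integral_add i1 i2, e1, e2,
            integral_add i45 i3, integral_add i4 i5]
      _ = ∫ _, 0 ∂μ := by
          refine integral_congr_ae (.of_forall fun ω => ?_)
          have h7 : avg κ (E.indicator r) (ω l) = r (ω l) - 1 := congrFun hTr (ω l)
          have h8 : avg κ g (ω l) = g (ω l) - (r (ω l) - 1 - L) := congrFun hg (ω l)
          dsimp only
          rw [h7, h8]
          simp only [hh]
          ring
      _ = 0 := by simp
  set B := 2 * A ^ 2 * (C + 1)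
  have hNsq : ∀ l : ℕ, ∫ ω, N l ω ^ 2 ∂μ ≤ B * (l + 1) := by
    intro l
    induction l with
    | zero => simpa [hN, hZ] using hVsq 0
    | succ l ih =>
      have hi : Integrable (fun ω => N l ω ^ 2) μ := hNint l fun z => z ^ 2
      have hiD : Integrable (fun ω => 2 * (N l ω * (N (l + 1) ω - N l ω))) μ :=
        hNN l fun y z => 2 * (y * (z - y))
      have hiDsq : Integrable (fun ω => (N (l + 1) ω - N l ω) ^ 2) μ :=
        hNN l fun y z => (z - y) ^ 2
      have hi' : Integrable (fun ω => N l ω ^ 2 + 2 * (N l ω * (N (l + 1) ω - N l ω))) μ :=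
        hi.add hiD
      have hexp : ∫ ω, N (l + 1) ω ^ 2 ∂μ = ∫ ω, N l ω ^ 2 ∂μ
          + 2 * ∫ ω, N l ω * (N (l + 1) ω - N l ω) ∂μ + ∫ ω, (N (l + 1) ω - N l ω) ^ 2 ∂μ := by
        rw [← integral_const_mul, ← integral_add hi hiD, ← integral_add hi' hiDsq]
        exact integral_congr_ae (.of_forall fun ω => by dsimp only; ring)
      rw [hexp, horth]
      push_cast
      linarith [hDsq l]
  -- Removing the corrector costs a factor two: $Z^2\le 2N^2+2h^2\,$, with integral at most
  -- $2B(l+1)+2B$.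
  refine ⟨4 * B, fun l => ?_⟩
  calc ∫ ω, Z l ω ^ 2 ∂μ ≤ ∫ ω, (2 * N l ω ^ 2 + 2 * h (ω l) (age E ω l) ^ 2) ∂μ := by
        refine integral_mono
          (integrable_of_dependsOn (dependsOn_sum_age l L fun _ _ z => z ^ 2) μ)
          (integrable_of_dependsOn (dependsOn_sum_age l L
            fun x w z => 2 * (z + h x w) ^ 2 + 2 * h x w ^ 2) μ) fun ω => ?_
        simp only [hN]
        nlinarith [sq_nonneg (Z l ω + 2 * h (ω l) (age E ω l))]
    _ = 2 * ∫ ω, N l ω ^ 2 ∂μ + 2 * ∫ ω, h (ω l) (age E ω l) ^ 2 ∂μ := by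
        rw [integral_add ((hNint l fun z => z ^ 2).const_mul 2)
          ((integrable_age_coord l fun x w => h x w ^ 2).const_mul 2), integral_const_mul,
          integral_const_mul]
    _ ≤ _ := by
        have hB0 : 0 ≤ B := by positivity
        have h1 := hNsq l
        have h2 := hVsq l
        have h3 : (0 : ℝ) ≤ l := l.cast_nonneg
        nlinarith [mul_nonneg hB0 h3]

end FiniteChain

/-- A strong law for monotone processes with linearly growing variance. -/
theorem ae_tendsto_div_of_monotone_of_variance_le {Ω : Type*} [MeasurableSpace Ω] {μ : Measure Ω}
    {u : ℕ → Ω → ℝ} {L C : ℝ} (hmono : ∀ ω, Monotone fun l => u l ω)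
    (hint : ∀ l, Integrable (fun ω => (u l ω - l * L) ^ 2) μ)
    (hvar : ∀ l : ℕ, ∫ ω, (u l ω - l * L) ^ 2 ∂μ ≤ C * (l + 1)) :
    ∀ᵐ ω ∂μ, Tendsto (fun l : ℕ => u l ω / l) atTop (𝓝 L) := by
  -- Along squares the mean square deviations of $u_l/l$ are $O(1/k^2)$, hence summable, while
  -- consecutive squares have ratio tending to $1$, so monotonicity fills the gaps.
  set c : ℕ → ℕ := fun k => (k + 1) ^ 2
  set V : ℕ → Ω → ℝ := fun k ω => (u (c k) ω / c k - L) ^ 2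
  have hVeq : ∀ k ω, V k ω = ((c k : ℝ) ^ 2)⁻¹ * (u (c k) ω - c k * L) ^ 2 := fun k ω => by
    have : (c k : ℝ) ≠ 0 := by positivity
    simp only [V]
    field_simp
  have hVint : ∀ k, Integrable (V k) μ := fun k => by
    simp_rw [funext (hVeq k)]
    exact (hint (c k)).const_mul _
  have hV0 : ∀ k ω, 0 ≤ V k ω := fun k ω => sq_nonneg _
  have hC : 0 ≤ C := by
    have h := (integral_nonneg fun ω => sq_nonneg _).trans (hvar 0)
    simpa using h
  have hVle : ∀ k, ∫ ω, V k ω ∂μ ≤ 2 * C * (1 / ((k : ℝ) + 1) ^ 2) := fun k => by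
    simp_rw [hVeq]
    rw [integral_const_mul]
    have h1 : (1 : ℝ) ≤ c k := by exact_mod_cast Nat.one_le_pow _ _ k.succ_pos
    calc ((c k : ℝ) ^ 2)⁻¹ * ∫ ω, (u (c k) ω - c k * L) ^ 2 ∂μ
        ≤ ((c k : ℝ) ^ 2)⁻¹ * (C * (2 * c k)) :=
          mul_le_mul_of_nonneg_left ((hvar (c k)).trans
            (mul_le_mul_of_nonneg_left (by linarith) hC)) (by positivity)
      _ = 2 * C * (1 / ((k : ℝ) + 1) ^ 2) := by
          simp only [c]
          push_cast
          field_simp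
  have hsum : Summable fun k => ∫ ω, V k ω ∂μ := by
    refine Summable.of_nonneg_of_le (fun k => integral_nonneg (hV0 k)) hVle ?_
    refine Summable.mul_left _ ?_
    have := (summable_nat_add_iff 1).2 (Real.summable_one_div_nat_pow.2 (one_lt_two))
    simpa using this
  have hae : ∀ᵐ ω ∂μ, Summable fun k => V k ω := by
    have hfin : ∑' k, eLpNorm (V k) 1 μ ≠ ⊤ := by
      have : ∀ k, eLpNorm (V k) 1 μ = ENNReal.ofReal (∫ ω, V k ω ∂μ) := fun k => by
        rw [eLpNorm_one_eq_lintegral_enorm,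
          ofReal_integral_eq_lintegral_ofReal (hVint k) (.of_forall (hV0 k))]
        exact lintegral_congr fun ω => Real.enorm_of_nonneg (hV0 k ω)
      simp_rw [this]
      exact hsum.tsum_ofReal_ne_top
    filter_upwards [summable_norm_of_tsum_eLpNorm_ne_top le_rfl
      (fun k => (hVint k).aestronglyMeasurable) hfin] with ω hω
    exact hω.of_norm
  filter_upwards [hae] with ω hω
  refine tendsto_div_of_monotone_of_exists_subseq_tendsto_div (fun l => u l ω) L (hmono ω)
    fun a ha => ⟨c, ?_, ?_, ?_⟩
  · have hlim : Tendsto (fun k : ℕ => (1 + 1 / ((k : ℝ) + 1)) ^ 2) atTop (𝓝 1) := by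
      have := ((tendsto_one_div_add_atTop_nhds_zero_nat (𝕜 := ℝ)).const_add 1).pow 2
      simpa using this
    filter_upwards [hlim.eventually_le_const ha] with k hk
    have h1 : ((c (k + 1) : ℕ) : ℝ) = (1 + 1 / ((k : ℝ) + 1)) ^ 2 * c k := by
      simp only [c]
      push_cast
      field_simp
    rw [h1]
    exact mul_le_mul_of_nonneg_right hk (Nat.cast_nonneg _)
  · exact tendsto_atTop_mono (fun k => by simp only [c, id]; nlinarith) tendsto_id
  · have h1 := hω.tendsto_atTop_zero
    have h2 : Tendsto (fun k => |u (c k) ω / c k - L|) atTop (𝓝 0) := by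
      have := (Real.continuous_sqrt.tendsto 0).comp h1
      simpa [Function.comp_def, V, Real.sqrt_sq_eq_abs] using this
    exact tendsto_iff_dist_tendsto_zero.2 (by simpa only [Real.dist_eq] using h2)

namespace FiniteChain

variable {S : Type*} [Fintype S] [MeasurableSpace S] [MeasurableSingletonClass S]
variable {κ : Kernel S S} [IsMarkovKernel κ] {E : Set S}
variable {μ : Measure (ℕ → S)} [IsProbabilityMeasure μ]

theorem ae_tendsto_average_age (hμ : IsMarkovLaw κ μ) {π : Measure S}
    [IsProbabilityMeasure π] (hπ : κ.Invariant π)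
    (hosc : ∀ f, Summable fun n => osc ((avg κ ^ n) f))
    (hT : Summable fun n => ‖(kill κ E ^ n) (1 : S → ℝ)‖) :
    ∀ᵐ ω ∂μ, Tendsto (fun l : ℕ => 1 / (l : ℝ) * ∑ n ∈ Icc 1 l, age E ω n) atTop
      (𝓝 (∑' k, ∫ x, (kill κ E ^ (k + 1)) 1 x ∂π)) := by
  obtain ⟨C, hC⟩ := exists_integral_sum_age_sq_le (E := E) hμ hπ hosc hT
  set L := ∑' k, ∫ x, (kill κ E ^ (k + 1)) 1 x ∂π
  -- The age vanishes at time $0$, so including $m=0$ on the right only costs an extra $-L$.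
  have hZ : ∀ (l : ℕ) ω, ∑ n ∈ Icc 1 l, age E ω n - l * L
      = ∑ m ∈ range (l + 1), (age E ω m - L) + L := fun l ω => by
    have h1 : Icc 1 l = Ico 1 (l + 1) := by ext; simp
    rw [h1, sum_sub_distrib, sum_Ico_eq_sub _ (by omega)]
    simp [age]
    ring
  have hint : ∀ l : ℕ, Integrable (fun ω => (∑ n ∈ Icc 1 l, age E ω n - l * L) ^ 2) μ := by
    intro l
    simp_rw [hZ]
    exact integrable_of_dependsOn
      (dependsOn_sum_age (E := E) (l + 1) L fun _ _ z => (z + L) ^ 2) μ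
  have hvar : ∀ l : ℕ, ∫ ω, (∑ n ∈ Icc 1 l, age E ω n - l * L) ^ 2 ∂μ
      ≤ (4 * |C| + 2 * L ^ 2) * (l + 1) := by
    intro l
    have h1 : Integrable (fun ω => (∑ m ∈ range (l + 1), (age E ω m - L)) ^ 2) μ :=
      integrable_of_dependsOn (dependsOn_sum_age (E := E) (l + 1) L fun _ _ z => z ^ 2) μ
    calc ∫ ω, (∑ n ∈ Icc 1 l, age E ω n - l * L) ^ 2 ∂μ
        ≤ ∫ ω, (2 * (∑ m ∈ range (l + 1), (age E ω m - L)) ^ 2 + 2 * L ^ 2) ∂μ := by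
          refine integral_mono (hint l) ((h1.const_mul 2).add (integrable_const _)) fun ω => ?_
          dsimp only
          rw [hZ]
          nlinarith [sq_nonneg (∑ m ∈ range (l + 1), (age E ω m - L) - L)]
      _ = 2 * ∫ ω, (∑ m ∈ range (l + 1), (age E ω m - L)) ^ 2 ∂μ + 2 * L ^ 2 := by
          rw [integral_add (h1.const_mul 2) (integrable_const _), integral_const_mul]
          simp
      _ ≤ _ := by
          have h2 := hC (l + 1)
          push_cast at h2
          have h3 : (0 : ℝ) ≤ l := l.cast_nonneg
          nlinarith [le_abs_self C, abs_nonneg C, mul_nonneg (sq_nonneg L) h3,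
            mul_nonneg (abs_nonneg C) h3,
            mul_nonneg (sub_nonneg.2 (le_abs_self C)) h3]
  have hmono : ∀ ω : ℕ → S, Monotone fun l => ∑ n ∈ Icc 1 l, age E ω n := fun ω l l' h =>
    sum_le_sum_of_subset_of_nonneg (Icc_subset_Icc_right h) fun _ _ _ => age_nonneg _ _
  filter_upwards [ae_tendsto_div_of_monotone_of_variance_le hmono hint hvar] with ω hω
  exact hω.congr fun l => by ring

end FiniteChain

/-! ### Series of nonnegative functions and summation by parts -/

/-- Beppo Levi for series of nonnegative real functions. -/
theorem integrable_and_integral_eq_of_hasSum {Ω : Type*} [MeasurableSpace Ω] {μ : Measure Ω}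
    {F : ℕ → Ω → ℝ} {f : Ω → ℝ} {s : ℝ} (hF : ∀ k, Integrable (F k) μ) (h0 : ∀ k ω, 0 ≤ F k ω)
    (hsum : HasSum (fun k => ∫ ω, F k ω ∂μ) s)
    (hpt : ∀ᵐ ω ∂μ, HasSum (fun k => F k ω) (f ω)) :
    Integrable f μ ∧ ∫ ω, f ω ∂μ = s := by
  have hint : ∫ ω, f ω ∂μ = s := by
    have hnorm : Summable fun k => ∫ ω, ‖F k ω‖ ∂μ :=
      hsum.summable.congr fun k => by
        simp_rw [Real.norm_of_nonneg (h0 k _)]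
    rw [← (hasSum_integral_of_summable_integral_norm hF hnorm).unique hsum]
    exact integral_congr_ae (hpt.mono fun ω hω => hω.tsum_eq.symm)
  refine ⟨⟨?_, ?_⟩, hint⟩
  · refine aestronglyMeasurable_of_tendsto_ae atTop
      (f := fun n ω => ∑ k ∈ range n, F k ω) (fun n => ?_) (hpt.mono fun ω hω => ?_)
    · exact (integrable_finsetSum _ fun k _ => hF k).aestronglyMeasurable
    · exact hω.tendsto_sum_nat
  · have h1 : ∫⁻ ω, ‖f ω‖ₑ ∂μ = ∑' k, ENNReal.ofReal (∫ ω, F k ω ∂μ) := by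
      simp_rw [ofReal_integral_eq_lintegral_ofReal (hF _) (.of_forall (h0 _))]
      rw [← lintegral_tsum fun k => (hF k).aemeasurable.ennreal_ofReal]
      refine lintegral_congr_ae (hpt.mono fun ω hω => ?_)
      dsimp only
      rw [Real.enorm_of_nonneg (hω.nonneg fun k => h0 k ω), ← hω.tsum_eq,
        ENNReal.ofReal_tsum_of_nonneg (fun k => h0 k ω) hω.summable]
    rw [HasFiniteIntegral, h1]
    exact hsum.summable.tsum_ofReal_lt_top

theorem hasSum_sub_succ {a : ℕ → ℝ} (ha : Antitone a) (hlim : Tendsto a atTop (𝓝 0)) :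
    HasSum (fun k => a k - a (k + 1)) (a 0) := by
  rw [hasSum_iff_tendsto_nat_of_nonneg fun k => sub_nonneg.2 (ha k.le_succ)]
  simp_rw [sum_range_sub']
  simpa using hlim.const_sub (a 0)

/-- Abel summation; the boundary term $n a_n$ vanishes in the limit for a summable antitone
sequence. -/
theorem hasSum_mul_sub_succ {a : ℕ → ℝ} (ha : Antitone a) (h0 : ∀ n, 0 ≤ a n)
    (hs : Summable a) :
    HasSum (fun k : ℕ => ((k : ℝ) + 1) * (a k - a (k + 1))) (∑' k, a k) := by
  rw [hasSum_iff_tendsto_nat_of_nonneg fun k =>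
    mul_nonneg (by positivity) (sub_nonneg.2 (ha k.le_succ))]
  have h1 : ∀ n : ℕ, ∑ k ∈ range n, ((k : ℝ) + 1) * (a k - a (k + 1))
      = ∑ k ∈ range n, a k - n * a n := by
    intro n
    induction n with
    | zero => simp
    | succ n ih => rw [sum_range_succ, ih, sum_range_succ]; push_cast; ring
  simp_rw [h1]
  simpa using hs.hasSum.tendsto_sum_nat.sub (tendsto_mul_of_antitone_summable ha h0 hs)

namespace FiniteChain

variable {S : Type*} [Fintype S] [MeasurableSpace S] [MeasurableSingletonClass S]
variable {κ : Kernel S S} [IsMarkovKernel κ] {E : Set S}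

/-! ### Lengths of the sojourns in a set -/

/-- Paths that start outside of `E` and then spend at least `k` steps in `E`. -/
def entry (E : Set S) (k : ℕ) : Set (ℕ → S) := {ω | ω 0 ∉ E ∧ ∀ j < k, ω (j + 1) ∈ E}

/-- The first positive time at which the path leaves `E` in the next step. -/
noncomputable def exitTime (E : Set S) (ω : ℕ → S) : ℕ :=
  sInf {r | 0 < r ∧ ω r ∈ E ∧ ω (r + 1) ∉ E}

theorem entry_anti {k l : ℕ} (h : k ≤ l) : entry E l ⊆ entry E k :=
  fun _ hω => ⟨hω.1, fun j hj => hω.2 j (hj.trans_le h)⟩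

theorem entry_one : entry E 1 = {ω | ω 0 ∉ E ∧ ω 1 ∈ E} := by
  ext ω; simp [entry]

theorem dependsOn_entry {k n : ℕ} (h : k ≤ n) :
    DependsOn (fun ω => (entry E k).indicator (1 : (ℕ → S) → ℝ) ω) (Set.Iic n) :=
  fun ω ω' hω => by
    have h1 : ω ∈ entry E k ↔ ω' ∈ entry E k := by
      simp only [entry, Set.mem_ofPred_eq, hω 0 (Nat.zero_le _)]
      refine and_congr_right fun _ => forall₂_congr fun j hj => ?_
      rw [hω (j + 1) (Set.mem_Iic.2 (by omega))]
    by_cases h2 : ω ∈ entry E k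
    · simp [h2, h1.1 h2]
    · simp [h2, mt h1.2 h2]

theorem measurableSet_entry (k : ℕ) : MeasurableSet (entry E k) := by
  have h := measurable_of_dependsOn (dependsOn_entry (E := E) (le_refl k))
  exact (measurable_indicator_const_iff (1 : ℝ)).1 h

/-- Identifies the entry events with the tail events of `exitTime`. Paths that never leave must be
excluded, since the infimum of the empty set is $0$. -/
theorem mem_entry_iff_of_exists {ω : ℕ → S} (h1 : ω ∈ entry E 1) (h2 : ∃ k, ω ∉ entry E k)
    (k : ℕ) : ω ∈ entry E (k + 1) ↔ k < exitTime E ω := by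
  classical
  have h3 : ∃ j, ω (j + 1) ∉ E := by
    obtain ⟨k, hk⟩ := h2
    by_contra! h
    exact hk ⟨h1.1, fun j _ => h j⟩
  have hlt : ∀ j < Nat.find h3, ω (j + 1) ∈ E := fun j hj => not_not.1 (Nat.find_min h3 hj)
  have hpos : 0 < Nat.find h3 := by
    rw [Nat.find_pos]
    exact not_not.2 (h1.2 0 one_pos)
  have hW : exitTime E ω = Nat.find h3 := by
    refine le_antisymm (Nat.sInf_le ⟨hpos, ?_, Nat.find_spec h3⟩)
      (le_csInf ⟨_, hpos, ?_, Nat.find_spec h3⟩ fun r hr => Nat.find_le hr.2.2)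
    all_goals
      have := hlt (Nat.find h3 - 1) (by omega)
      rwa [Nat.sub_add_cancel hpos] at this
  rw [hW]
  refine ⟨fun h => ?_, fun h => ⟨h1.1, fun j hj => hlt j (by omega)⟩⟩
  by_contra! hle
  exact Nat.find_spec h3 (h.2 _ (by omega))

theorem hasSum_ite_lt (W : ℕ) (c : ℕ → ℝ) :
    HasSum (fun k => if k < W then c k else 0) (∑ k ∈ range W, c k) := by
  have h : HasSum (fun k => if k < W then c k else 0)
      (∑ k ∈ range W, if k < W then c k else 0) :=
    hasSum_sum_of_ne_finset_zero fun k hk => if_neg (by simpa using hk)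
  rwa [Finset.sum_congr rfl fun k hk => if_pos (mem_range.1 hk)] at h

section Law

variable {μ : Measure (ℕ → S)} [IsProbabilityMeasure μ]

theorem integral_entry_mul (hμ : IsMarkovLaw κ μ) (k : ℕ) (f : S → ℝ) :
    ∫ ω, (entry E k).indicator 1 ω * f (ω k) ∂μ
      = ∫ ω, Eᶜ.indicator ((kill κ E ^ k) f) (ω 0) ∂μ := by
  induction k generalizing f with
  | zero =>
    refine integral_congr_ae (.of_forall fun ω => ?_)
    by_cases h : ω 0 ∈ E <;> simp [entry, h]
  | succ k ih =>
    have h1 : ∀ ω : ℕ → S, (entry E (k + 1)).indicator (1 : (ℕ → S) → ℝ) ω * f (ω (k + 1))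
        = (entry E k).indicator 1 ω * E.indicator f (ω (k + 1)) := fun ω => by
      have h2 : ω ∈ entry E (k + 1) ↔ ω ∈ entry E k ∧ ω (k + 1) ∈ E := by
        simp only [entry, Set.mem_ofPred_eq, Nat.lt_succ_iff_lt_or_eq, or_imp, forall_and,
          forall_eq, and_assoc]
      by_cases h3 : ω ∈ entry E k <;> by_cases h4 : ω (k + 1) ∈ E <;> simp [h2, h3, h4]
    simp_rw [h1]
    rw [hμ k _ (dependsOn_entry le_rfl), pow_succ, Module.End.mul_apply]
    exact ih _

theorem integral_kill_pow_succ {π : Measure S} [IsProbabilityMeasure π] (hπ : κ.Invariant π)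
    (k : ℕ) (f : S → ℝ) : ∫ x, (kill κ E ^ (k + 1)) f x ∂π
      = ∫ x, E.indicator ((kill κ E ^ k) f) x ∂π := by
  rw [pow_succ', Module.End.mul_apply, kill_apply, integral_avg hπ]

/-- Remove from the event $X_1,\dots,X_k\in E$ the part with $X_0\in E$; by stationarity that part
has the probability of $k+1$ consecutive slots in $E$. -/
theorem measureReal_entry (hμ : IsMarkovLaw κ μ) {π : Measure S} [IsProbabilityMeasure π]
    (hπ : κ.Invariant π) (h0 : μ.map (fun ω => ω 0) = π) (k : ℕ) :
    μ.real (entry E k) = ∫ x, (kill κ E ^ k) 1 x ∂π - ∫ x, (kill κ E ^ (k + 1)) 1 x ∂π := by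
  have h1 := integral_entry_mul (E := E) hμ k 1
  simp only [Pi.one_apply, mul_one] at h1
  rw [integral_indicator_one (measurableSet_entry k)] at h1
  rw [h1, integral_kill_pow_succ hπ,
    ← integral_sub (integrable_of_finite _ _) (integrable_of_finite _ _), ← h0,
    integral_map (measurable_pi_apply 0).aemeasurable .of_discrete]
  refine integral_congr_ae (.of_forall fun ω => ?_)
  by_cases h : ω 0 ∈ E <;> simp [h]

/-- In stationary conditions, sojourns in `E` and in its complement start equally often. -/
theorem measureReal_entry_one_compl (hμ : IsMarkovLaw κ μ) {π : Measure S}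
    [IsProbabilityMeasure π] (hπ : κ.Invariant π) (h0 : μ.map (fun ω => ω 0) = π) :
    μ.real (entry Eᶜ 1) = μ.real (entry E 1) := by
  have h2 : kill κ Eᶜ 1 = 1 - kill κ E 1 := by
    have : Eᶜ.indicator (1 : S → ℝ) = 1 - E.indicator 1 := Set.indicator_compl E 1
    rw [kill_apply, this, map_sub, avg_one, kill_apply]
  rw [measureReal_entry hμ hπ h0, measureReal_entry hμ hπ h0, integral_kill_pow_succ hπ,
    integral_kill_pow_succ hπ 1, integral_kill_pow_succ hπ, integral_kill_pow_succ hπ 1,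
    ← integral_sub (integrable_of_finite _ _) (integrable_of_finite _ _),
    ← integral_sub (integrable_of_finite _ _) (integrable_of_finite _ _), ← sub_eq_zero,
    ← integral_sub (integrable_of_finite _ _) (integrable_of_finite _ _)]
  -- The two crossing probabilities differ by $P(X_1\in E)-P(X_0\in E)$, which is zero under $\pi$.
  have h3 : ∫ x, (kill κ E 1 x - E.indicator 1 x) ∂π = 0 := by
    rw [integral_sub (integrable_of_finite _ _) (integrable_of_finite _ _), kill_apply,
      integral_avg hπ, sub_self]
  rw [← h3]
  refine integral_congr_ae (.of_forall fun x => ?_)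
  by_cases h : x ∈ E <;> simp [h, h2]

/-- First and second moments of the length of a sojourn in `E`. -/
theorem integral_exitTime (hμ : IsMarkovLaw κ μ) {π : Measure S} [IsProbabilityMeasure π]
    (hπ : κ.Invariant π) (h0 : μ.map (fun ω => ω 0) = π)
    (hT : Summable fun n => ‖(kill κ E ^ n) (1 : S → ℝ)‖) :
    IntegrableOn (fun ω => (exitTime E ω : ℝ)) (entry E 1) μ ∧
    IntegrableOn (fun ω => (exitTime E ω : ℝ) ^ 2) (entry E 1) μ ∧
    ∫ ω in entry E 1, (exitTime E ω : ℝ) ∂μ = π.real E ∧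
    ∫ ω in entry E 1, (exitTime E ω : ℝ) ^ 2 ∂μ
      = 2 * (∑' k, ∫ x, (kill κ E ^ (k + 1)) 1 x ∂π) - π.real E := by
  set a : ℕ → ℝ := fun k => ∫ x, (kill κ E ^ (k + 1)) 1 x ∂π with ha
  have ha0 : ∀ k, 0 ≤ a k := fun k => integral_nonneg (kill_pow_nonneg _ zero_le_one)
  have hanti : Antitone a := fun k l h =>
    integral_mono (integrable_of_finite _ _) (integrable_of_finite _ _)
      (kill_pow_one_antitone (Nat.succ_le_succ h))
  have hsum : Summable a := (hasSum_integral (π := π)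
    ((hasSum_nat_add_iff' 1).2 (hasSum_lifetime hT))).summable
  have hreal : ∀ k, μ.real (entry E (k + 1)) = a k - a (k + 1) := fun k =>
    measureReal_entry hμ hπ h0 (k + 1)
  have hazero : a 0 = π.real E := by
    simp only [a]
    rw [integral_kill_pow_succ hπ, pow_zero, Module.End.one_apply,
      integral_indicator_one E.toFinite.measurableSet]
  have hlim : Tendsto a atTop (𝓝 0) := hsum.tendsto_atTop_zero
  -- Staying in $E$ forever after an entry has probability at most $a_k-a_{k+1}$ for every $k$,
  -- hence zero.
  have hae : ∀ᵐ ω ∂μ, ∃ k, ω ∉ entry E k := by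
    have h1 : μ.real (⋂ k, entry E (k + 1)) ≤ 0 := by
      have hl := hlim.sub (hlim.comp (tendsto_add_atTop_nat 1))
      rw [sub_zero] at hl
      refine ge_of_tendsto' hl fun k => ?_
      have := measureReal_mono (μ := μ) (Set.iInter_subset (fun k => entry E (k + 1)) k)
      rwa [hreal] at this
    have h2 : μ (⋂ k, entry E (k + 1)) = 0 :=
      (measureReal_eq_zero_iff).1 (le_antisymm h1 measureReal_nonneg)
    filter_upwards [measure_eq_zero_iff_ae_notMem.1 h2] with ω hω
    rw [Set.mem_iInter, not_forall] at hω
    obtain ⟨k, hk⟩ := hω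
    exact ⟨_, hk⟩
  -- Layer-cake formula: $\sum_{k<W}c_k=\sum_k c_k 1_{\{W>k\}}$, integrated term by term. The
  -- weights $1$ and $k+1$ give the two moments.
  have key : ∀ c : ℕ → ℝ, (∀ k, 0 ≤ c k) → ∀ s, HasSum (fun k => c k * (a k - a (k + 1))) s →
      IntegrableOn (fun ω => ∑ k ∈ range (exitTime E ω), c k) (entry E 1) μ ∧
      ∫ ω in entry E 1, ∑ k ∈ range (exitTime E ω), c k ∂μ = s := by
    intro c hc s hs
    rw [← integrable_indicator_iff (measurableSet_entry 1),
      ← integral_indicator (measurableSet_entry 1)]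
    refine integrable_and_integral_eq_of_hasSum
      (F := fun k ω => c k * (entry E (k + 1)).indicator 1 ω) (fun k => ?_) (fun k ω => ?_) ?_ ?_
    · exact ((integrable_const (1 : ℝ)).indicator (measurableSet_entry _)).const_mul _
    · exact mul_nonneg (hc k) (Set.indicator_nonneg (fun _ _ => zero_le_one) _)
    · refine hs.congr_fun fun k => ?_
      rw [integral_const_mul, integral_indicator_one (measurableSet_entry _), hreal]
    · filter_upwards [hae] with ω hω
      by_cases h : ω ∈ entry E 1
      · rw [Set.indicator_of_mem h]
        refine (hasSum_ite_lt _ c).congr_fun fun k => ?_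
        by_cases hk : k < exitTime E ω
        · simp [hk, (mem_entry_iff_of_exists h hω k).2 hk]
        · simp [hk, mt (mem_entry_iff_of_exists h hω k).1 hk]
      · rw [Set.indicator_of_notMem h]
        refine hasSum_zero.congr_fun fun k => ?_
        rw [Set.indicator_of_notMem (fun hk => h (entry_anti (by omega) hk)), mul_zero]
  obtain ⟨i1, e1⟩ := key (fun _ => 1) (fun _ => zero_le_one) (a 0)
    ((hasSum_sub_succ hanti hlim).congr_fun fun k => one_mul _)
  obtain ⟨i2, e2⟩ := key (fun k => (k : ℝ) + 1) (fun k => by positivity) (∑' k, a k)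
    (hasSum_mul_sub_succ hanti ha0 hsum)
  simp only [sum_const, card_range, nsmul_eq_mul, mul_one] at i1 e1
  have hsq : ∀ ω : ℕ → S, (exitTime E ω : ℝ) ^ 2
      = 2 * ∑ k ∈ range (exitTime E ω), ((k : ℝ) + 1) - exitTime E ω := fun ω => by
    generalize exitTime E ω = n
    induction n with
    | zero => simp
    | succ n ih =>
      rw [sum_range_succ]
      push_cast
      linarith
  have i3 := (i2.const_mul 2).sub i1
  refine ⟨i1, ?_, e1.trans hazero, ?_⟩
  · exact i3.congr (.of_forall fun ω => (hsq ω).symm)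
  · simp_rw [hsq]
    rw [integral_sub (i2.const_mul 2) i1, integral_const_mul, e1, e2, hazero]

end Law

/-! ### Minorization -/

/-- A two-step minorization follows from a common state reachable in two steps. -/
theorem exists_minorization {z : S} (hz : ∀ x, ∃ y, κ x {y} ≠ 0 ∧ κ y {z} ≠ 0) :
    ∃ ε : ℝ, 0 < ε ∧ ε ≤ 1 ∧
      ∀ f : S → ℝ, 0 ≤ f → (fun _ => ε * f z) ≤ (avg κ ^ 2) f := by
  have : Nonempty S := ⟨z⟩
  choose y hy hyz using hz
  obtain ⟨m, hm⟩ := Finite.exists_min fun x => (κ x).real {y x} * (κ (y x)).real {z}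
  have hge : ∀ (x s : S) (f : S → ℝ), 0 ≤ f → (κ x).real {s} * f s ≤ avg κ f x := by
    intro x s f hf
    have h1 : ∫ t, ({s} : Set S).indicator f t ∂κ x = (κ x).real {s} * f s := by
      rw [integral_indicator (measurableSet_singleton s), integral_singleton, smul_eq_mul]
    rw [← h1]
    exact avg_mono (κ := κ) (Set.indicator_le_self' fun t _ => hf t) x
  refine ⟨(κ m).real {y m} * (κ (y m)).real {z}, ?_, ?_, fun f hf x => ?_⟩
  · exact mul_pos (ENNReal.toReal_pos (hy m) (measure_ne_top _ _))
      (ENNReal.toReal_pos (hyz m) (measure_ne_top _ _))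
  · exact mul_le_one₀ measureReal_le_one measureReal_nonneg measureReal_le_one
  · rw [pow_two, Module.End.mul_apply]
    calc _ ≤ (κ x).real {y x} * (κ (y x)).real {z} * f z :=
          mul_le_mul_of_nonneg_right (hm x) (hf z)
      _ = (κ x).real {y x} * ((κ (y x)).real {z} * f z) := by ring
      _ ≤ (κ x).real {y x} * avg κ f (y x) :=
          mul_le_mul_of_nonneg_left (hge _ _ f hf) measureReal_nonneg
      _ ≤ _ := hge _ _ _ (avg_nonneg hf)

section Minorization

variable {ε : ℝ} {z : S}

/-- The killed chain dies within two steps with probability at least $\varepsilon$, by being at $z$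
after two steps. -/
theorem summable_norm_kill_of_notMem (hε : 0 < ε)
    (hz : ∀ f : S → ℝ, 0 ≤ f → (fun _ => ε * f z) ≤ (avg κ ^ 2) f) (hzE : z ∉ E) :
    Summable fun n => ‖(kill κ E ^ n) (1 : S → ℝ)‖ := by
  refine summable_norm_kill_pow_one (N := 2) (c := 1 - ε) (by linarith) fun x => ?_
  have h1 : (kill κ E ^ 2) 1 ≤ (avg κ ^ 2) (E.indicator 1) := by
    rw [pow_two, Module.End.mul_apply, pow_two, Module.End.mul_apply]
    exact kill_le_avg (kill_nonneg zero_le_one)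
  have h2 : (avg κ ^ 2) (E.indicator 1) = 1 - (avg κ ^ 2) (Eᶜ.indicator 1) := by
    have : Eᶜ.indicator (1 : S → ℝ) = 1 - E.indicator 1 := Set.indicator_compl E 1
    rw [this, map_sub, avg_pow_one, sub_sub_cancel]
  have h3 := hz (Eᶜ.indicator 1) (Set.indicator_nonneg fun _ _ => zero_le_one) x
  have h4 := h1 x
  rw [h2] at h4
  simp only [Set.indicator_of_mem (show z ∈ Eᶜ from hzE), Pi.one_apply, mul_one] at h3
  simp only [Pi.sub_apply, Pi.one_apply] at h4
  linarith

/-- Here $z$ itself is no death state, so a third step, from $z$ into $E$, is needed. -/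
theorem summable_norm_kill_compl (hε : 0 < ε)
    (hz : ∀ f : S → ℝ, 0 ≤ f → (fun _ => ε * f z) ≤ (avg κ ^ 2) f)
    (hzE : 0 < kill κ E 1 z) :
    Summable fun n => ‖(kill κ Eᶜ ^ n) (1 : S → ℝ)‖ := by
  refine summable_norm_kill_pow_one (N := 3) (c := 1 - ε * kill κ E 1 z)
    (by linarith [mul_pos hε hzE]) fun x => ?_
  have h1 : (kill κ Eᶜ ^ 3) 1 ≤ (avg κ ^ 2) (kill κ Eᶜ 1) := by
    rw [pow_succ, Module.End.mul_apply]
    exact kill_pow_le_avg_pow 2 (kill_nonneg zero_le_one)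
  have h2 : kill κ Eᶜ 1 = 1 - kill κ E 1 := by
    have : Eᶜ.indicator (1 : S → ℝ) = 1 - E.indicator 1 := Set.indicator_compl E 1
    rw [kill_apply, this, map_sub, avg_one, kill_apply]
  have h3 := hz _ (kill_nonneg (κ := κ) (E := E) zero_le_one) x
  have h4 := h1 x
  rw [h2, map_sub, avg_pow_one] at h4
  simp only [Pi.sub_apply, Pi.one_apply] at h4 h3
  linarith

/-- The stationary mass of $z$ is at least $\varepsilon$, and a step from $z$ enters $E$ with
positive probability. -/
theorem measureReal_entry_one_pos {μ : Measure (ℕ → S)} [IsProbabilityMeasure μ]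
    (hμ : IsMarkovLaw κ μ) {π : Measure S} [IsProbabilityMeasure π] (hπ : κ.Invariant π)
    (h0 : μ.map (fun ω => ω 0) = π) (hε : 0 < ε)
    (hz : ∀ f : S → ℝ, 0 ≤ f → (fun _ => ε * f z) ≤ (avg κ ^ 2) f) (hzE : z ∉ E)
    (hzE' : 0 < kill κ E 1 z) : 0 < μ.real (entry E 1) := by
  have h1 := integral_entry_mul (E := E) hμ 1 1
  simp only [Pi.one_apply, mul_one, pow_one] at h1
  rw [integral_indicator_one (measurableSet_entry 1),
    ← integral_map (φ := fun ω : ℕ → S => ω 0) (f := Eᶜ.indicator (kill κ E 1))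
      (measurable_pi_apply 0).aemeasurable .of_discrete, h0, ← integral_avg_pow hπ 2] at h1
  rw [h1]
  have h2 := hz (Eᶜ.indicator (kill κ E 1))
    (Set.indicator_nonneg fun x _ => kill_nonneg zero_le_one x)
  rw [Set.indicator_of_mem (show z ∈ Eᶜ from hzE)] at h2
  have h3 := integral_mono (integrable_of_finite π _) (integrable_of_finite π _) h2
  simp only [integral_const, probReal_univ, one_smul] at h3
  exact (mul_pos hε hzE').trans_le h3

end Minorization

end FiniteChain

/-! ### The collision channel -/

section Channel

open FiniteChain

variable {M : ℕ} (i : Fin M)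

/-- States in which the estimate is wrong. -/
def errStates : Set (AlohaState M) := {s | s.1 i ≠ s.2}

variable {i}

theorem estErr_eq_one_iff {ω : ℕ → AlohaState M} {n : ℕ} :
    estErr i ω n = 1 ↔ ω n ∈ errStates i := by
  by_cases h : (ω n).1 i = (ω n).2 <;> simp [estErr, errStates, h]

theorem estErr_eq_zero_iff {ω : ℕ → AlohaState M} {n : ℕ} :
    estErr i ω n = 0 ↔ ω n ∉ errStates i := by
  by_cases h : (ω n).1 i = (ω n).2 <;> simp [estErr, errStates, h]

theorem isErrStart_iff {ω : ℕ → AlohaState M} {n : ℕ} :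
    IsErrStart (estErr i ω) n ↔ ω n ∉ errStates i ∧ ω (n + 1) ∈ errStates i := by
  rw [IsErrStart, estErr_eq_zero_iff, estErr_eq_one_iff]

theorem isErrReset_iff {ω : ℕ → AlohaState M} {n : ℕ} :
    IsErrReset (estErr i ω) n ↔ ω n ∈ errStates i ∧ ω (n + 1) ∉ errStates i := by
  rw [IsErrReset, estErr_eq_zero_iff, estErr_eq_one_iff]

theorem startEvent_eq : startEvent i = entry (errStates i) 1 := by
  ext ω
  rw [entry_one]
  exact isErrStart_iff

theorem resetEvent_eq : resetEvent i = entry (errStates i)ᶜ 1 := by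
  ext ω
  rw [entry_one]
  exact isErrReset_iff.trans (and_congr_left' not_not.symm)

theorem errPeriod_eq (ω : ℕ → AlohaState M) : errPeriod i ω = exitTime (errStates i) ω := by
  simp only [errPeriod, exitTime, isErrReset_iff]

theorem okPeriod_eq (ω : ℕ → AlohaState M) : okPeriod i ω = exitTime (errStates i)ᶜ ω := by
  simp only [okPeriod, exitTime, isErrStart_iff, Set.mem_compl_iff, not_not]

theorem age_of_notMem {S : Type*} {E : Set S} {ω : ℕ → S} {n : ℕ} (h : ω n ∉ E) :
    age E ω n = 0 := by
  cases n with
  | zero => rfl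
  | succ n => exact Set.indicator_of_notMem h _

/-- A start instant is a slot with correct knowledge, so the last start does not move during an
error period, and it equals $n$ when slot $n+1$ is the first one in error. If the error is present
from time $0$, both sides count from $0$. -/
theorem age_eq_sub_lastErrStart {ω : ℕ → AlohaState M} (n : ℕ) (h : ω n ∈ errStates i) :
    age (errStates i) ω n = n - lastErrStart (estErr i ω) n := by
  induction n with
  | zero =>
    have : lastErrStart (estErr i ω) 0 = 0 :=
      Nat.le_zero.1 (csSup_le' fun m hm => hm.1)
    simp [this, age]
  | succ n ih =>
    have hlast : lastErrStart (estErr i ω) (n + 1) = lastErrStart (estErr i ω) n := by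
      unfold lastErrStart
      congr 1
      ext m
      refine and_congr_left fun hm => ⟨fun hle => ?_, fun hle => hle.trans n.le_succ⟩
      rcases hle.lt_or_eq with hlt | rfl
      · exact Nat.lt_succ_iff.1 hlt
      · exact absurd h (isErrStart_iff.1 hm).1
    rw [hlast, age, Set.indicator_of_mem h]
    by_cases hn : ω n ∈ errStates i
    · rw [ih hn]
      push_cast
      ring
    · have : lastErrStart (estErr i ω) n = n :=
        le_antisymm (csSup_le' fun m hm => hm.1)
          (le_csSup ⟨n, fun m hm => hm.1⟩ ⟨le_rfl, isErrStart_iff.2 ⟨hn, h⟩⟩)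
      rw [this, age_of_notMem hn]
      push_cast
      ring

theorem aoii_eq_age (n : ℕ) (ω : ℕ → AlohaState M) :
    aoii i n ω = age (errStates i) ω n := by
  by_cases h : ω n ∈ errStates i
  · rw [aoii, estErr_eq_one_iff.2 h, age_eq_sub_lastErrStart n h, Nat.cast_one, one_mul]
  · rw [aoii, estErr_eq_zero_iff.2 h, age_of_notMem h, Nat.cast_zero, zero_mul]

/-! ### Positive transition probabilities -/

theorem bernoulliMeasure_ne_zero_left {X : Type*} [MeasurableSpace X] {x y : X}
    {p : unitInterval} (hp : 0 < p) {s : Set X} (hs : x ∈ s) :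
    bernoulliMeasure x y p s ≠ 0 := by
  have hp' : unitInterval.toNNReal p ≠ 0 := by
    simpa [← NNReal.coe_ne_zero, unitInterval.coe_toNNReal] using hp.ne'
  have hd : Measure.dirac x s ≠ 0 := by
    rw [Measure.dirac_apply_of_mem hs]; exact one_ne_zero
  rw [bernoulliMeasure_def, Measure.add_apply]
  refine fun h => ?_
  have h1 := (add_eq_zero.1 h).1
  rw [Measure.smul_apply, ENNReal.smul_def, smul_eq_mul, mul_eq_zero] at h1
  exact h1.elim (by simpa using hp') hd

theorem bernoulliMeasure_ne_zero_right {X : Type*} [MeasurableSpace X] {x y : X}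
    {p : unitInterval} (hp : p < 1) {s : Set X} (hs : y ∈ s) :
    bernoulliMeasure x y p s ≠ 0 := by
  have h : bernoulliMeasure x y p = bernoulliMeasure y x (unitInterval.symm p) := by
    rw [bernoulliMeasure_def, bernoulliMeasure_def, unitInterval.symm_symm, add_comm]
  rw [h]
  exact bernoulliMeasure_ne_zero_left (unitInterval.pos_iff_ne_zero.2 fun h =>
    hp.ne (unitInterval.symm_eq_zero.1 h)) hs

namespace AlohaParams

variable {prm : AlohaParams}

theorem nodeLaw_ne_zero {x y b : Bool}
    (hy : bernoulliMeasure (!x) x (prm.flipProb x) {y} ≠ 0)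
    (hb : bernoulliMeasure (y, true) (y, false) (prm.txProb x y) {(y, b)} ≠ 0) :
    prm.nodeLaw x {(y, b)} ≠ 0 := by
  rw [nodeLaw, Measure.bind_apply (measurableSet_singleton _)
    (measurable_of_countable _).aemeasurable]
  refine ((ENNReal.mul_pos hb hy).trans_le ?_).ne'
  rw [← lintegral_singleton
    (fun y' => bernoulliMeasure (y', true) (y', false) (prm.txProb x y') {(y, b)}) y]
  exact setLIntegral_le_lintegral _ _

theorem bernoulli_flip_ne_zero {x : Bool} (h : 0 < prm.flipProb x) :
    bernoulliMeasure (!x) x (prm.flipProb x) {!x} ≠ 0 :=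
  bernoulliMeasure_ne_zero_left h rfl

theorem bernoulli_stay_ne_zero {x : Bool} (h : prm.flipProb x < 1) :
    bernoulliMeasure (!x) x (prm.flipProb x) {x} ≠ 0 :=
  bernoulliMeasure_ne_zero_right h rfl

theorem bernoulli_transmit_ne_zero {x y : Bool} (h : 0 < prm.txProb x y) :
    bernoulliMeasure (y, true) (y, false) (prm.txProb x y) {(y, true)} ≠ 0 :=
  bernoulliMeasure_ne_zero_left h rfl

theorem bernoulli_silent_ne_zero {x y : Bool} (h : prm.txProb x y < 1) :
    bernoulliMeasure (y, true) (y, false) (prm.txProb x y) {(y, false)} ≠ 0 :=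
  bernoulliMeasure_ne_zero_right h rfl

theorem exists_nodeLaw_ne_zero {x y : Bool}
    (hy : bernoulliMeasure (!x) x (prm.flipProb x) {y} ≠ 0) :
    ∃ b, prm.nodeLaw x {(y, b)} ≠ 0 := by
  rcases (bot_le (a := prm.txProb x y)).eq_or_lt with h | h
  · exact ⟨false, nodeLaw_ne_zero hy (bernoulli_silent_ne_zero (h ▸ zero_lt_one))⟩
  · exact ⟨true, nodeLaw_ne_zero hy (bernoulli_transmit_ne_zero h)⟩

theorem txProb_self (x : Bool) : prm.txProb x x = prm.αs := if_pos rfl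

theorem txProb_not (x : Bool) : prm.txProb x (!x) = prm.αc := if_neg (by simp)

theorem flipProb_pos (h01 : 0 < prm.p01) (h10 : 0 < prm.p10) (x : Bool) :
    0 < prm.flipProb x := by
  cases x
  · exact h01
  · exact h10

end AlohaParams

open AlohaParams

variable {prm : AlohaParams}

theorem slotKernel_ne_zero {s : AlohaState M} {o : Fin M → Bool × Bool}
    (h : ∀ j, prm.nodeLaw (s.1 j) {o j} ≠ 0) :
    slotKernel prm i s {slotUpdate i s o} ≠ 0 := by
  change ((Measure.pi fun j => prm.nodeLaw (s.1 j)).map (slotUpdate i s)) _ ≠ 0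
  rw [Measure.map_apply (measurable_of_countable _) (measurableSet_singleton _)]
  have h1 : (Measure.pi fun j => prm.nodeLaw (s.1 j)) {o} ≠ 0 := by
    rw [Measure.pi_singleton]
    exact Finset.prod_ne_zero_iff.2 fun j _ => h j
  exact fun h2 => h1 (measure_mono_null (by simp) h2)

/-- A state with a correct estimate that can be reached in two slots from every state. -/
theorem exists_common_state (h01 : 0 < prm.p01) (h10 : 0 < prm.p10)
    (haper : prm.p01 < 1 ∨ prm.p10 < 1) (hsome : 0 < prm.αc ∨ 0 < prm.αs)
    (hnotall : prm.αc < 1 ∨ prm.αs < 1) :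
    ∃ z : AlohaState M, z ∉ errStates i ∧
      ∀ s, ∃ t, slotKernel prm i s {t} ≠ 0 ∧ slotKernel prm i t {z} ≠ 0 := by
  have hflip := flipProb_pos h01 h10
  -- A source can reach $x$ in one slot from either state and, once there, can both stay and flip.
  -- The first slot brings all sources to $x$; in the second the tagged terminal alone transmits,
  -- which erases any dependence on the old estimate.
  obtain ⟨x, hx⟩ : ∃ x, prm.flipProb x < 1 :=
    haper.elim (fun h => ⟨false, h⟩) fun h => ⟨true, h⟩
  obtain ⟨y, hy⟩ : ∃ y, prm.nodeLaw x {(y, true)} ≠ 0 := by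
    rcases hsome with h | h
    · exact ⟨!x, nodeLaw_ne_zero (bernoulli_flip_ne_zero (hflip x))
        (bernoulli_transmit_ne_zero (by rwa [txProb_not]))⟩
    · exact ⟨x, nodeLaw_ne_zero (bernoulli_stay_ne_zero hx)
        (bernoulli_transmit_ne_zero (by rwa [txProb_self]))⟩
  obtain ⟨y', hsil⟩ : ∃ y, prm.nodeLaw x {(y, false)} ≠ 0 := by
    rcases hnotall with h | h
    · exact ⟨!x, nodeLaw_ne_zero (bernoulli_flip_ne_zero (hflip x))
        (bernoulli_silent_ne_zero (by rwa [txProb_not]))⟩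
    · exact ⟨x, nodeLaw_ne_zero (bernoulli_stay_ne_zero hx)
        (bernoulli_silent_ne_zero (by rwa [txProb_self]))⟩
  let o : Fin M → Bool × Bool := fun j => if j = i then (y, true) else (y', false)
  refine ⟨(fun j => (o j).1, y), by simp [errStates, o], fun s => ?_⟩
  have hstep : ∀ j, ∃ b, prm.nodeLaw (s.1 j) {(x, b)} ≠ 0 := fun j => by
    refine exists_nodeLaw_ne_zero ?_
    by_cases hj : x = s.1 j
    · rw [← hj]
      exact bernoulli_stay_ne_zero hx
    · rw [Bool.eq_not.2 hj]
      exact bernoulli_flip_ne_zero (hflip _)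
  choose b hb using hstep
  refine ⟨slotUpdate i s fun j => (x, b j), slotKernel_ne_zero hb, ?_⟩
  have hz : ((fun j => (o j).1, y) : AlohaState M)
      = slotUpdate i (slotUpdate i s fun j => (x, b j)) o := by
    refine Prod.ext rfl ?_
    have h : (o i).2 = true ∧ ∀ j, j ≠ i → (o j).2 = false :=
      ⟨by simp [o], fun j hj => by simp [o, hj]⟩
    simp only [slotUpdate, if_pos h]
    simp [o]
  rw [hz]
  refine slotKernel_ne_zero fun j => ?_
  change prm.nodeLaw x {o j} ≠ 0
  by_cases hj : j = i
  · simpa [o, hj] using hy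
  · simpa [o, hj] using hsil

/-- From every state with a correct estimate, an error can occur in the next slot. -/
theorem exists_slotKernel_errStates (h01 : 0 < prm.p01) (h10 : 0 < prm.p10)
    (herr : 2 ≤ M ∨ prm.αc < 1) {z : AlohaState M} (hz : z ∉ errStates i) :
    ∃ t ∈ errStates i, slotKernel prm i z {t} ≠ 0 := by
  have hflip := flipProb_pos h01 h10
  have hzi : z.1 i = z.2 := not_not.1 hz
  obtain ⟨o, ho, hoi, hlost⟩ : ∃ o : Fin M → Bool × Bool, (∀ j, prm.nodeLaw (z.1 j) {o j} ≠ 0) ∧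
      (o i).1 = !(z.1 i) ∧ ¬((o i).2 = true ∧ ∀ j, j ≠ i → (o j).2 = false) := by
    -- All sources flip, and the tagged update must be lost: by silence when $\alpha_c<1$, and by a
    -- collision with another terminal when $\alpha_c=1$.
    by_cases hc : prm.αc < 1
    · choose b hb using fun j =>
        exists_nodeLaw_ne_zero (bernoulli_flip_ne_zero (hflip (z.1 j)))
      refine ⟨fun j => (!(z.1 j), if j = i then false else b j), fun j => ?_, rfl, by simp⟩
      by_cases hj : j = i
      · simp only [hj, if_true]
        exact nodeLaw_ne_zero (bernoulli_flip_ne_zero (hflip _))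
          (bernoulli_silent_ne_zero (by rwa [txProb_not]))
      · simpa only [hj, if_false] using hb j
    · have hM : 2 ≤ M := herr.resolve_right hc
      have : Nontrivial (Fin M) := Fin.nontrivial_iff_two_le.2 hM
      obtain ⟨k, hk⟩ := exists_ne i
      refine ⟨fun j => (!(z.1 j), true), fun j => ?_, rfl, fun h => by simpa using h.2 k hk⟩
      exact nodeLaw_ne_zero (bernoulli_flip_ne_zero (hflip _))
        (bernoulli_transmit_ne_zero (by
          rw [txProb_not]; exact zero_lt_one.trans_le (not_lt.1 hc)))
  refine ⟨slotUpdate i z o, ?_, slotKernel_ne_zero ho⟩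
  simp only [errStates, Set.mem_ofPred_eq, slotUpdate, if_neg hlost, hoi, ← hzi]
  simp

end Channel

end

/-! ### The long-run average AoII -/

theorem lemma1 {M : ℕ} (i : Fin M) (prm : AlohaParams)
    -- the two-state sources are irreducible and aperiodic
    (h01 : 0 < prm.p01) (h10 : 0 < prm.p10) (haper : prm.p01 < 1 ∨ prm.p10 < 1)
    -- updates can be delivered: not always silent, not always transmitting
    (hsome : 0 < prm.αc ∨ 0 < prm.αs) (hnotall : prm.αc < 1 ∨ prm.αs < 1)
    -- error periods can occur
    (herr : 2 ≤ M ∨ prm.αc < 1) :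
    (∃! π : Measure (AlohaState M), IsStationaryLaw prm i π) ∧
    ∀ π : Measure (AlohaState M), IsStationaryLaw prm i π →
      -- error and correct-knowledge periods do start, and the moments of `W` and `Y` are finite
      0 < pathLaw prm i π (startEvent i) ∧ 0 < pathLaw prm i π (resetEvent i) ∧
      Integrable (fun ω => errPeriod i ω) (errLaw prm i π) ∧
      Integrable (fun ω => errPeriod i ω ^ 2) (errLaw prm i π) ∧
      Integrable (fun ω => okPeriod i ω) (okLaw prm i π) ∧
      -- average AoII, for every initial law of the system
      ∀ ν : Measure (AlohaState M), IsProbabilityMeasure ν →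
        (∀ᵐ ω ∂(pathLaw prm i ν),
          Filter.Tendsto (fun l : ℕ => (1 / (l : ℝ)) * ∑ n ∈ Finset.Icc 1 l, aoii i n ω)
            Filter.atTop
            (nhds (((∫ ω', errPeriod i ω' ^ 2 ∂(errLaw prm i π)) +
                ∫ ω', errPeriod i ω' ∂(errLaw prm i π)) /
              (2 * ((∫ ω', errPeriod i ω' ∂(errLaw prm i π)) +
                ∫ ω', okPeriod i ω' ∂(okLaw prm i π)))))) ∧
        (∀ n : ℕ, Integrable (fun ω => aoii i n ω) (pathLaw prm i ν)) ∧
        Filter.Tendsto (fun n : ℕ => ∫ ω, aoii i n ω ∂(pathLaw prm i ν))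
          Filter.atTop
          (nhds (((∫ ω', errPeriod i ω' ^ 2 ∂(errLaw prm i π)) +
              ∫ ω', errPeriod i ω' ∂(errLaw prm i π)) /
            (2 * ((∫ ω', errPeriod i ω' ∂(errLaw prm i π)) +
              ∫ ω', okPeriod i ω' ∂(okLaw prm i π))))) := by
  set E := errStates i
  obtain ⟨z, hzE, hz⟩ := exists_common_state (i := i) h01 h10 haper hsome hnotall
  obtain ⟨t, htE, ht⟩ := exists_slotKernel_errStates h01 h10 herr hzE
  obtain ⟨ε, hε, hε1, hmin⟩ := FiniteChain.exists_minorization hz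
  have hosc := FiniteChain.summable_osc hε1 hε hmin
  have hzE' : 0 < FiniteChain.kill (slotKernel prm i) E 1 z := by
    rw [FiniteChain.kill_apply, FiniteChain.avg_apply,
      integral_indicator_one E.toFinite.measurableSet]
    exact ENNReal.toReal_pos (fun h => ht (measure_mono_null (Set.singleton_subset_iff.2 htE) h))
      (measure_ne_top _ _)
  have hT := FiniteChain.summable_norm_kill_of_notMem hε hmin hzE
  have hT' := FiniteChain.summable_norm_kill_compl hε hmin hzE'
  have hlaw : ∀ ν : Measure (AlohaState M), IsProbabilityMeasure ν →
      IsProbabilityMeasure (pathLaw prm i ν) ∧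
        FiniteChain.IsMarkovLaw (slotKernel prm i) (pathLaw prm i ν) := fun ν _ =>
    ⟨inferInstanceAs (IsProbabilityMeasure (Kernel.trajMeasure _ _)),
      FiniteChain.isMarkovLaw_trajMeasure ν⟩
  refine ⟨?_, fun π hπ => ?_⟩
  · obtain ⟨π, hP, hπ⟩ := FiniteChain.exists_invariant hosc
    refine ⟨π, ⟨hP, hπ⟩, fun π' hπ' => ?_⟩
    have := hπ'.1
    exact FiniteChain.invariant_unique hosc hπ'.2 hπ
  obtain ⟨hP, hπ⟩ := hπ
  obtain ⟨hPπ, hμ⟩ := hlaw π hP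
  have h0 : (pathLaw prm i π).map (fun ω => ω 0) = π := FiniteChain.map_zero_trajMeasure π
  have hp := FiniteChain.measureReal_entry_one_pos hμ hπ h0 hε hmin hzE hzE'
  have hp' := FiniteChain.measureReal_entry_one_compl (E := E) hμ hπ h0
  have hq : 0 < (pathLaw prm i π).real (FiniteChain.entry Eᶜ 1) := hp'.symm ▸ hp
  obtain ⟨iW, iW2, eW, eW2⟩ := FiniteChain.integral_exitTime hμ hπ h0 hT
  obtain ⟨iY, -, eY, -⟩ := FiniteChain.integral_exitTime hμ hπ h0 hT'
  set p := (pathLaw prm i π).real (FiniteChain.entry E 1) with hpdef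
  have hpos : pathLaw prm i π (FiniteChain.entry E 1) ≠ 0 :=
    fun h => hp.ne' (by rw [hpdef, measureReal_def, h, ENNReal.toReal_zero])
  have hpos' : pathLaw prm i π (FiniteChain.entry Eᶜ 1) ≠ 0 :=
    fun h => hq.ne' (by rw [measureReal_def, h, ENNReal.toReal_zero])
  have hcond : ∀ (A : Set (ℕ → AlohaState M)) (f : (ℕ → AlohaState M) → ℝ),
      ∫ ω, f ω ∂(ProbabilityTheory.cond (pathLaw prm i π) A)
        = ((pathLaw prm i π).real A)⁻¹ * ∫ ω in A, f ω ∂(pathLaw prm i π) := fun A f => by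
    rw [ProbabilityTheory.cond, integral_smul_measure, ENNReal.toReal_inv, smul_eq_mul]
    rfl
  -- With $p$ the common probability of a start and of a reset, $E[W]=\pi(E)/p$,
  -- $E[W^2]=(2L-\pi(E))/p$ and $E[Y]=(1-\pi(E))/p$, so the quotient is $(2L/p)/(2/p)$.
  have hlim : ((∫ ω', errPeriod i ω' ^ 2 ∂(errLaw prm i π)) +
      ∫ ω', errPeriod i ω' ∂(errLaw prm i π)) /
      (2 * ((∫ ω', errPeriod i ω' ∂(errLaw prm i π)) +
        ∫ ω', okPeriod i ω' ∂(okLaw prm i π)))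
      = ∑' k, ∫ x, (FiniteChain.kill (slotKernel prm i) E ^ (k + 1)) 1 x ∂π := by
    simp_rw [errLaw, okLaw, startEvent_eq, resetEvent_eq, errPeriod_eq, okPeriod_eq]
    rw [hcond, hcond, hcond, eW, eW2, eY, hp', ← hpdef, probReal_compl_eq_one_sub
      E.toFinite.measurableSet]
    field_simp
    ring
  simp_rw [hlim]
  simp only [errLaw, okLaw, startEvent_eq, resetEvent_eq, errPeriod_eq, okPeriod_eq,
    aoii_eq_age]
  refine ⟨pos_iff_ne_zero.2 hpos, pos_iff_ne_zero.2 hpos',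
    iW.smul_measure (ENNReal.inv_ne_top.2 hpos), iW2.smul_measure (ENNReal.inv_ne_top.2 hpos),
    iY.smul_measure (ENNReal.inv_ne_top.2 hpos'), fun ν hν => ?_⟩
  obtain ⟨_, hμν⟩ := hlaw ν hν
  exact ⟨FiniteChain.ae_tendsto_average_age hμν hπ hosc hT,
    fun n => FiniteChain.integrable_age_coord n fun _ w => w,
    FiniteChain.tendsto_integral_age hμν hπ hosc hT⟩
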